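/- Let $\mathbb D$ be the open unit disc and $H(\mathbb D)$ the space of analytic functions on $\mathbb D$. A positive continuous function $\phi$ on $[0,1)$ is called normal if there are constants $b>a>0$ such that, on $[0,1)$, $\phi(r)/(1-r)^a$ is non-increasing and tends to $0$ as $r\to1^-$, and $\phi(r)/(1-r)^b$ is non-decreasing and tends to $\infty$ as $r\to1^-$. For $0<p,q<\infty$ and $\phi$ normal, $H(p,q,\phi)$ is the space of all $f\in H(\mathbb D)$ with $$\|f\|_{p,q,\phi}^p=\int_0^1 M_q(f,r)^p\,\frac{\phi(r)^p}{1-r}\,dr<\infty,\qquad M_q(f,r)=\Big(\frac1{2\pi}\int_0^{2\pi}|f(re^{i\theta})|^q\,d\theta\Big)^{1/q}.$$ For a weight $\mu$ (a positive continuous function on $\mathbb D$), $\mathcal B_\mu$ is the space of all $f\in H(\mathbb D)$ with $\|f\|_{\mathcal B_\mu}=|f(0)|+\sup_{z\in\mathbb D}\mu(|z|)|f'(z)|<\infty$. For $n\in\{0,1,2,\dots\}$, $g\in H(\mathbb D)$ and an analytic map $\psi:\mathbb D\to\mathbb D$, put $$(C^n_{\psi,g}f)(z)=\int_0^z f^{(n)}(\psi(\xi))\,g(\xi)\,d\xi,\qquad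 f\in H(\mathbb D),\ z\in\mathbb D.$$ The essential norm of an operator $T:H(p,q,\phi)\to\mathcal B_\mu$ is $\|T\|_e=\inf_S\|T-S\|$, where $S$ runs over the compact linear operators $H(p,q,\phi)\to\mathcal B_\mu$ and $\|T-S\|=\sup_{\|f\|_{p,q,\phi}\le1}\|Tf-Sf\|_{\mathcal B_\mu}$. **Theorem.** Let $p,q\in(0,\infty)$, let $\phi$ be normal and let $n\in\{0,1,2,\dots\}$. There are constants $c,C>0$, depending only on $p,q,\phi,n$, such that for every weight $\mu$, every $g\in H(\mathbb D)$ and every analytic $\psi:\mathbb D\to\mathbb D$ for which $C^n_{\psi,g}:H(p,q,\phi)\to\mathcal B_\mu$ is bounded, $$c\,L\le\|C^n_{\psi,g}\|_e\le C\,L,\qquad L=\limsup_{|\psi(z)|\to1}\frac{\mu(|z|)\,|g(z)|}{\phi(|\psi(z)|)\,(1-|\psi(z)|^2)^{1/q+n}},$$ where $L$ is understood to be $0$ if $\sup_{z\in\mathbb D}|\psi(z)|<1$. -/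

import Mathlib

open Set Filter Topology MeasureTheory
open scoped ENNReal

/-- The space `H(𝔻)` of analytic functions on the open unit disc. An element is represented by its
extension by zero to `ℂ`, so that two elements are equal exactly when they agree on the disc. -/
def discAnalytic : Submodule ℂ (ℂ → ℂ) where
  carrier := {f | DifferentiableOn ℂ f (Metric.ball 0 1) ∧ ∀ z ∉ Metric.ball (0 : ℂ) 1, f z = 0}
  zero_mem' := ⟨differentiableOn_const 0, fun _ _ => rfl⟩
  add_mem' := fun {f g} hf hg => ⟨hf.1.add hg.1, fun z hz => by simp [hf.2 z hz, hg.2 z hz]⟩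
  smul_mem' := fun c f hf => ⟨hf.1.const_smul c, fun z hz => by simp [hf.2 z hz]⟩

/-- A positive continuous function `φ` on `[0, 1)` is normal if there are `b > a > 0` such that
`φ(r) / (1 - r) ^ a` decreases to `0` and `φ(r) / (1 - r) ^ b` increases to `∞` as `r → 1⁻`. -/
def IsNormalFunction (φ : ℝ → ℝ) : Prop :=
  ContinuousOn φ (Ico 0 1) ∧ (∀ r ∈ Ico (0 : ℝ) 1, 0 < φ r) ∧
    ∃ a b : ℝ, 0 < a ∧ a < b ∧
      AntitoneOn (fun r => φ r / (1 - r) ^ a) (Ico 0 1) ∧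
      Tendsto (fun r => φ r / (1 - r) ^ a) (𝓝[<] 1) (𝓝 0) ∧
      MonotoneOn (fun r => φ r / (1 - r) ^ b) (Ico 0 1) ∧
      Tendsto (fun r => φ r / (1 - r) ^ b) (𝓝[<] 1) atTop

/-- A weight: a positive continuous function on the open unit disc. -/
def IsWeight (μ : ℂ → ℝ) : Prop :=
  ContinuousOn μ (Metric.ball 0 1) ∧ ∀ z ∈ Metric.ball (0 : ℂ) 1, 0 < μ z

/-- An analytic self-map of the open unit disc (values outside the disc are irrelevant). -/
def IsAnalyticSelfMap (ψ : ℂ → ℂ) : Prop :=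
  DifferentiableOn ℂ ψ (Metric.ball 0 1) ∧ MapsTo ψ (Metric.ball 0 1) (Metric.ball 0 1)

/-- The integral mean `M_q(f, r)`. -/
noncomputable def integralMean (q : ℝ) (f : ℂ → ℂ) (r : ℝ) : ℝ :=
  ((2 * Real.pi)⁻¹ *
    ∫ θ in (0 : ℝ)..(2 * Real.pi), ‖f (r * Complex.exp (θ * Complex.I))‖ ^ q) ^ (1 / q)

/-- The `p`-th power of the mixed norm, with value `∞` when the integral diverges. -/
noncomputable def mixedNormPow (p q : ℝ) (φ : ℝ → ℝ) (f : ℂ → ℂ) : ℝ≥0∞ :=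
  ∫⁻ r in Ioo (0 : ℝ) 1, ENNReal.ofReal (integralMean q f r ^ p * (φ r ^ p / (1 - r)))

/-- The (quasi-)norm of `H(p, q, φ)`. -/
noncomputable def mixedNorm (p q : ℝ) (φ : ℝ → ℝ) (f : ℂ → ℂ) : ℝ≥0∞ :=
  mixedNormPow p q φ f ^ (1 / p)

theorem add_rpow_le_two_rpow_mul {a b s : ℝ} (ha : 0 ≤ a) (hb : 0 ≤ b) (hs : 0 ≤ s) :
    (a + b) ^ s ≤ 2 ^ s * (a ^ s + b ^ s) := by
  have h1 : (a + b) ^ s ≤ (2 * max a b) ^ s := by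
    apply Real.rpow_le_rpow (by positivity) _ hs
    linarith [le_max_left a b, le_max_right a b]
  rw [Real.mul_rpow (by norm_num) (le_max_of_le_left ha)] at h1
  refine h1.trans (mul_le_mul_of_nonneg_left ?_ (by positivity))
  rcases max_choice a b with h | h <;> rw [h]
  · linarith [Real.rpow_nonneg hb s]
  · linarith [Real.rpow_nonneg ha s]

theorem discAnalytic_measurable {f : ℂ → ℂ} (hf : f ∈ discAnalytic) : Measurable f := by
  classical
  have h : f = (Metric.ball (0 : ℂ) 1).piecewise f (fun _ => 0) := by
    funext z
    by_cases hz : z ∈ Metric.ball (0 : ℂ) 1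
    · simp [Set.piecewise, hz]
    · rw [Set.piecewise_eq_of_notMem _ _ _ hz, hf.2 z hz]
  rw [h]
  exact hf.1.continuousOn.measurable_piecewise continuousOn_const Metric.isOpen_ball.measurableSet

theorem integralMean_nonneg (q : ℝ) (f : ℂ → ℂ) (r : ℝ) : 0 ≤ integralMean q f r := by
  unfold integralMean
  refine Real.rpow_nonneg (mul_nonneg (by positivity) ?_) _
  exact intervalIntegral.integral_nonneg (by positivity) (fun _ _ => by positivity)

theorem integralMean_measurable (q : ℝ) {f : ℂ → ℂ} (hf : f ∈ discAnalytic) :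
    Measurable (integralMean q f) := by
  unfold integralMean
  refine Measurable.pow_const (Measurable.const_mul ?_ _) _
  simp only [intervalIntegral.integral_of_le Real.two_pi_pos.le]
  have hm : Measurable (fun x : ℝ × ℝ => ‖f (x.1 * Complex.exp (x.2 * Complex.I))‖ ^ q) := by
    refine ((discAnalytic_measurable hf).comp ?_).norm.pow_const q
    fun_prop
  exact (hm.stronglyMeasurable.integral_prod_right (ν := volume.restrict (Ioc 0 (2 * Real.pi)))).measurable

theorem integralMean_integrable {q : ℝ} (hq : 0 < q) {f : ℂ → ℂ} (hf : f ∈ discAnalytic)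
    {r : ℝ} (hr : r ∈ Ioo (0 : ℝ) 1) :
    IntervalIntegrable (fun θ : ℝ => ‖f (r * Complex.exp (θ * Complex.I))‖ ^ q) volume 0
      (2 * Real.pi) := by
  apply Continuous.intervalIntegrable
  refine Continuous.rpow_const (Continuous.norm ?_) (fun _ => Or.inr hq.le)
  refine hf.1.continuousOn.comp_continuous (by fun_prop) (fun θ => ?_)
  simp [Complex.norm_exp_ofReal_mul_I, abs_of_pos hr.1, hr.2]

theorem integralMean_add_le {q : ℝ} (hq : 0 < q) {f g : ℂ → ℂ} (hf : f ∈ discAnalytic)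
    (hg : g ∈ discAnalytic) {r : ℝ} (hr : r ∈ Ioo (0 : ℝ) 1) :
    integralMean q (f + g) r ≤
      (2 ^ q) ^ (1 / q) * (2 ^ (1 / q) * (integralMean q f r + integralMean q g r)) := by
  have hi := integralMean_integrable hq hf hr
  have hj := integralMean_integrable hq hg hr
  have hk := integralMean_integrable hq (discAnalytic.add_mem hf hg) hr
  have nn : ∀ h : ℂ → ℂ, 0 ≤ (2 * Real.pi)⁻¹ *
      ∫ θ in (0 : ℝ)..(2 * Real.pi), ‖h (r * Complex.exp (θ * Complex.I))‖ ^ q := fun h =>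
    mul_nonneg (by positivity)
      (intervalIntegral.integral_nonneg (by positivity) (fun _ _ => by positivity))
  have h1 : (∫ θ in (0 : ℝ)..(2 * Real.pi), ‖(f + g) (r * Complex.exp (θ * Complex.I))‖ ^ q) ≤
      2 ^ q * ((∫ θ in (0 : ℝ)..(2 * Real.pi), ‖f (r * Complex.exp (θ * Complex.I))‖ ^ q) +
        ∫ θ in (0 : ℝ)..(2 * Real.pi), ‖g (r * Complex.exp (θ * Complex.I))‖ ^ q) := by
    rw [← intervalIntegral.integral_add hi hj, ← intervalIntegral.integral_const_mul]
    refine intervalIntegral.integral_mono_on (by positivity) hk ((hi.add hj).const_mul _) ?_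
    intro θ _
    refine le_trans ?_ (add_rpow_le_two_rpow_mul (norm_nonneg _) (norm_nonneg _) hq.le)
    exact Real.rpow_le_rpow (norm_nonneg _) (norm_add_le _ _) hq.le
  unfold integralMean
  refine le_trans (Real.rpow_le_rpow (nn _) (mul_le_mul_of_nonneg_left h1 (by positivity))
    (by positivity)) ?_
  rw [mul_left_comm, Real.mul_rpow (by positivity) (by rw [mul_add]; exact add_nonneg (nn f) (nn g)),
    mul_add]
  refine mul_le_mul_of_nonneg_left ?_ (by positivity)
  exact add_rpow_le_two_rpow_mul (nn f) (nn g) (by positivity)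

/-- The mixed-norm space `H(p, q, φ)`, for `0 < p, q < ∞` and `φ` normal. -/
noncomputable def mixedNormSpace (p q : ℝ) (φ : ℝ → ℝ) (hp : 0 < p) (hq : 0 < q)
    (hφ : IsNormalFunction φ) : Submodule ℂ (ℂ → ℂ) where
  carrier := {f | f ∈ discAnalytic ∧ mixedNormPow p q φ f < ∞}
  zero_mem' := by
    refine ⟨discAnalytic.zero_mem, ?_⟩
    have h : ∀ r, integralMean q 0 r = 0 := fun r => by
      simp [integralMean, Real.zero_rpow hq.ne', Real.zero_rpow (inv_ne_zero hq.ne')]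
    simp [mixedNormPow, h, Real.zero_rpow hp.ne']
  add_mem' := by
    rintro f g ⟨hf, hf'⟩ ⟨hg, hg'⟩
    refine ⟨discAnalytic.add_mem hf hg, ?_⟩
    set K : ℝ := ((2 ^ q) ^ (1 / q) * 2 ^ (1 / q)) ^ p * 2 ^ p with hK
    have key : mixedNormPow p q φ (f + g) ≤
        ENNReal.ofReal K * (mixedNormPow p q φ f + mixedNormPow p q φ g) := by
      have hm : AEMeasurable (fun r : ℝ =>
          ENNReal.ofReal (integralMean q f r ^ p * (φ r ^ p / (1 - r))))
          (volume.restrict (Ioo (0 : ℝ) 1)) := by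
        refine AEMeasurable.ennreal_ofReal (AEMeasurable.mul
          ((integralMean_measurable q hf).pow_const p).aemeasurable (AEMeasurable.div ?_ ?_))
        · exact ((hφ.1.mono Ioo_subset_Ico_self).aemeasurable measurableSet_Ioo).pow_const p
        · exact (measurable_const.sub measurable_id).aemeasurable
      unfold mixedNormPow
      rw [← lintegral_add_left' hm, ← lintegral_const_mul' _ _ ENNReal.ofReal_ne_top]
      refine setLIntegral_mono' measurableSet_Ioo (fun r hr => ?_)
      have hw : 0 ≤ φ r ^ p / (1 - r) :=
        div_nonneg (Real.rpow_nonneg (hφ.2.1 r (Ioo_subset_Ico_self hr)).le _) (by linarith [hr.2])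
      have a1 := integralMean_nonneg q f r
      have a2 := integralMean_nonneg q g r
      rw [← ENNReal.ofReal_add (by positivity) (by positivity),
        ← ENNReal.ofReal_mul (by positivity), ← add_mul, ← mul_assoc]
      refine ENNReal.ofReal_le_ofReal (mul_le_mul_of_nonneg_right ?_ hw)
      refine (Real.rpow_le_rpow (integralMean_nonneg _ _ _) (integralMean_add_le hq hf hg hr)
        hp.le).trans ?_
      rw [← mul_assoc, Real.mul_rpow (by positivity) (by positivity), hK, mul_assoc]
      exact mul_le_mul_of_nonneg_left (add_rpow_le_two_rpow_mul a1 a2 hp.le) (by positivity)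
    exact key.trans_lt (ENNReal.mul_lt_top ENNReal.ofReal_lt_top (ENNReal.add_lt_top.2 ⟨hf', hg'⟩))
  smul_mem' := by
    rintro c f ⟨hf, hf'⟩
    refine ⟨discAnalytic.smul_mem c hf, ?_⟩
    have h : ∀ r, integralMean q (c • f) r = ‖c‖ * integralMean q f r := fun r => by
      have nn : 0 ≤ (2 * Real.pi)⁻¹ *
          ∫ θ in (0 : ℝ)..(2 * Real.pi), ‖f (r * Complex.exp (θ * Complex.I))‖ ^ q :=
        mul_nonneg (by positivity)
          (intervalIntegral.integral_nonneg (by positivity) (fun _ _ => by positivity))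
      simp only [integralMean, Pi.smul_apply, norm_smul,
        Real.mul_rpow (norm_nonneg c) (norm_nonneg _), intervalIntegral.integral_const_mul]
      rw [mul_left_comm, Real.mul_rpow (by positivity) nn, ← Real.rpow_mul (norm_nonneg c),
        mul_one_div_cancel hq.ne', Real.rpow_one]
    have h2 : mixedNormPow p q φ (c • f) = ENNReal.ofReal (‖c‖ ^ p) * mixedNormPow p q φ f := by
      unfold mixedNormPow
      rw [← lintegral_const_mul' _ _ ENNReal.ofReal_ne_top]
      refine lintegral_congr (fun r => ?_)
      rw [h, Real.mul_rpow (norm_nonneg c) (integralMean_nonneg q f r),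
        ← ENNReal.ofReal_mul (by positivity), mul_assoc]
    rw [h2]
    exact ENNReal.mul_lt_top ENNReal.ofReal_lt_top hf'

/-- The norm `|f(0)| + sup_{z ∈ 𝔻} μ(|z|) |f'(z)|` of the weighted Bloch space, with value `∞`
when the supremum is infinite. -/
noncomputable def blochNorm (μ : ℂ → ℝ) (f : ℂ → ℂ) : ℝ≥0∞ :=
  ‖f 0‖ₑ + ⨆ z ∈ Metric.ball (0 : ℂ) 1, ENNReal.ofReal (μ (‖z‖ : ℂ)) * ‖deriv f z‖ₑ

/-- The weighted Bloch space `𝓑_μ`. -/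
noncomputable def blochSpace (μ : ℂ → ℝ) : Submodule ℂ (ℂ → ℂ) where
  carrier := {f | f ∈ discAnalytic ∧ blochNorm μ f < ∞}
  zero_mem' := by
    refine ⟨discAnalytic.zero_mem, ?_⟩
    simp [blochNorm]
  add_mem' := by
    rintro f g ⟨hf, hf'⟩ ⟨hg, hg'⟩
    refine ⟨discAnalytic.add_mem hf hg, lt_of_le_of_lt ?_ (ENNReal.add_lt_top.2 ⟨hf', hg'⟩)⟩
    unfold blochNorm
    rw [add_add_add_comm]
    refine add_le_add (enorm_add_le _ _) (iSup₂_le fun z hz => ?_)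
    have hz' := Metric.isOpen_ball.mem_nhds hz
    rw [deriv_add (hf.1.differentiableAt hz') (hg.1.differentiableAt hz')]
    refine (mul_le_mul_right (enorm_add_le _ _) _).trans ?_
    rw [mul_add]
    exact add_le_add
      (le_iSup₂ (f := fun z (_ : z ∈ Metric.ball (0 : ℂ) 1) =>
        ENNReal.ofReal (μ (‖z‖ : ℂ)) * ‖deriv f z‖ₑ) z hz)
      (le_iSup₂ (f := fun z (_ : z ∈ Metric.ball (0 : ℂ) 1) =>
        ENNReal.ofReal (μ (‖z‖ : ℂ)) * ‖deriv g z‖ₑ) z hz)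
  smul_mem' := by
    rintro c f ⟨hf, hf'⟩
    refine ⟨discAnalytic.smul_mem c hf, lt_of_le_of_lt ?_
      (ENNReal.mul_lt_top (enorm_lt_top (x := c)) hf')⟩
    unfold blochNorm
    rw [mul_add, Pi.smul_apply, enorm_smul]
    refine add_le_add le_rfl (iSup₂_le fun z hz => ?_)
    have hz' := Metric.isOpen_ball.mem_nhds hz
    rw [deriv_const_smul c (hf.1.differentiableAt hz'), enorm_smul, mul_left_comm]
    exact mul_le_mul_right
      (le_iSup₂ (f := fun z (_ : z ∈ Metric.ball (0 : ℂ) 1) =>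
        ENNReal.ofReal (μ (‖z‖ : ℂ)) * ‖deriv f z‖ₑ) z hz) _

open Classical in
/-- The generalized integration operator `f ↦ ∫₀ᶻ f⁽ⁿ⁾(ψ(ξ)) g(ξ) dξ` on the disc, the integral
being taken along the segment `ξ = t z`, `0 ≤ t ≤ 1` (and the result extended by zero). -/
noncomputable def genIntegrationOp (n : ℕ) (ψ g : ℂ → ℂ) (f : ℂ → ℂ) : ℂ → ℂ := fun z =>
  if z ∈ Metric.ball (0 : ℂ) 1 then
    z * ∫ t in (0 : ℝ)..1, iteratedDeriv n f (ψ (t * z)) * g (t * z)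
  else 0

section operators

variable (p q : ℝ) (φ : ℝ → ℝ) (hp : 0 < p) (hq : 0 < q) (hφ : IsNormalFunction φ) (μ : ℂ → ℝ)

/-- `T` is bounded from `H(p, q, φ)` into `𝓑_μ`. -/
def IsBoundedMixedToBloch (T : (ℂ → ℂ) → ℂ → ℂ) : Prop :=
  ∃ K : ℝ, ∀ f ∈ mixedNormSpace p q φ hp hq hφ,
    T f ∈ blochSpace μ ∧ blochNorm μ (T f) ≤ ENNReal.ofReal K * mixedNorm p q φ f

/-- The linear operator `S` from `H(p, q, φ)` to `𝓑_μ` is compact: the image of every bounded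
sequence has a subsequence that converges in `𝓑_μ`. -/
def IsCompactMixedToBloch (S : mixedNormSpace p q φ hp hq hφ →ₗ[ℂ] blochSpace μ) : Prop :=
  ∀ (M : ℝ) (f : ℕ → mixedNormSpace p q φ hp hq hφ),
    (∀ k, mixedNorm p q φ (f k) ≤ ENNReal.ofReal M) →
    ∃ (h : blochSpace μ) (s : ℕ → ℕ), StrictMono s ∧
      Tendsto (fun j => blochNorm μ (S (f (s j)) - h : blochSpace μ)) atTop (𝓝 0)

/-- The essential norm `inf ‖T - S‖` over the compact linear operators `S` from `H(p, q, φ)` to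
`𝓑_μ`, where `‖T - S‖ = sup {‖T f - S f‖ : ‖f‖ ≤ 1}`. -/
noncomputable def essentialNorm (T : (ℂ → ℂ) → ℂ → ℂ) : ℝ≥0∞ :=
  ⨅ (S : mixedNormSpace p q φ hp hq hφ →ₗ[ℂ] blochSpace μ)
    (_ : IsCompactMixedToBloch p q φ hp hq hφ μ S),
    ⨆ (f : mixedNormSpace p q φ hp hq hφ) (_ : mixedNorm p q φ f ≤ 1),
      blochNorm μ (T f - (S f : ℂ → ℂ))

end operators

/-- The upper limit of `μ(|z|) |g(z)| / (φ(|ψ(z)|) (1 - |ψ(z)|²) ^ (1/q + n))` as `|ψ(z)| → 1`,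
`z` in the disc, in `[0, ∞]`. It is `0` when `sup |ψ| < 1`. -/
noncomputable def symbolLimsup (q : ℝ) (φ : ℝ → ℝ) (n : ℕ) (μ : ℂ → ℝ) (ψ g : ℂ → ℂ) : ℝ≥0∞ :=
  limsup (fun z : ℂ => ENNReal.ofReal
      (μ (‖z‖ : ℂ) * ‖g z‖ / (φ ‖ψ z‖ * (1 - ‖ψ z‖ ^ 2) ^ (1 / q + (n : ℝ)))))
    (comap (fun z => ‖ψ z‖) (𝓝[<] 1) ⊓ 𝓟 (Metric.ball 0 1))

/-! Write T for the operator. Since (T f)' = (f⁽ⁿ⁾ ∘ ψ) g and (T f)(0) = 0, every norm in question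
is a weighted supremum of |f⁽ⁿ⁾(ψ(z))| |g(z)|, and the theorem rests on the exact order of growth of
f⁽ⁿ⁾ on the unit ball of H(p,q,φ). That order is the reciprocal of G(s) = φ(s)(1-s)^(1/q+n), which
is `growthWeight`; replacing 1-s by 1-s² costs only a constant factor.

The growth bound (`NormalBounds.exists_norm_iteratedDeriv_mul_growthWeight_le`) comes from
subharmonicity. |f|^q has the sub-mean value property for every q > 0, so M_q(f,r) increases with r,
and the norm then controls M_q(f,r)φ(r). Averaging |f|^q over a disc about w of radius (1-|w|)/2,
and comparing with the annulus that contains it, costs (1-|w|)^(-1/q). Cauchy's estimate costs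
(1-|w|)^(-n). The growth is attained: the kernels (1-|w|)^t φ(|w|)⁻¹ (1 - w̄z)^(-N), t = N - 1/q >
b, have bounded norms and n-th derivative of size 1/G(|w|) at w (`NormalBounds.exists_kernels`).

Lower bound: choose z_k with |ψ(z_k)| → 1 along which the quotient defining L stays above M < L, and
let f_k be the kernel at ψ(z_k). If S is compact, S f_k → h along a subsequence. Test T - S on f_i -
f_j: the images under S nearly cancel, and f_j⁽ⁿ⁾(ψ(z_i)) → 0 as j → ∞ for fixed i. Hence the
contribution of f_i to T alone is bounded by a constant times ‖T - S‖. Differences of kernels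
replace weak convergence, so the argument works for all p, q > 0, where only a quasi-norm is at
hand.

Upper bound: let S be T composed with a Taylor polynomial of the dilation f(ρz). This has finite
rank, with bounded coefficient functionals, so it is compact
(`isCompactMixedToBloch_sum_smulRight`). The n-th derivative of the error is at most η on |w| ≤ R
and at most C/G(|w|) + η everywhere (`NormalBounds.exists_approximation`). Where |ψ(z)| ≤ R the
error is small because μ|g| is bounded (test T on ζⁿ); where |ψ(z)| > R it is bounded by a constant
times a quantity close to L. -/

/-! ### Subharmonicity of |f|^q and monotonicity of the integral means -/

/-- **Jensen's inequality**: the logarithm of the modulus of an analytic function is subharmonic. -/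
theorem log_norm_le_circleAverage {f : ℂ → ℂ} {c : ℂ} {R : ℝ} (hR : 0 < R)
    (hf : AnalyticOnNhd ℂ f (Metric.closedBall c R)) (hc : f c ≠ 0) :
    Real.log ‖f c‖ ≤ Real.circleAverage (fun z => Real.log ‖f z‖) c R := by
  have hf' : AnalyticOnNhd ℂ f (Metric.closedBall c |R|) := by rwa [abs_of_pos hR]
  rw [AnalyticOnNhd.circleAverage_log_norm hR.ne' hf' hc]
  refine le_add_of_nonneg_left (finsum_nonneg fun u => ?_)
  by_cases hu : u ∈ Metric.closedBall c |R|
  · refine mul_nonneg (by exact_mod_cast MeromorphicOn.AnalyticOnNhd.divisor_nonneg hf' u) ?_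
    rcases eq_or_ne u c with rfl | huc
    · simp
    · rw [abs_of_pos hR, mem_closedBall_iff_norm'] at hu
      have h0 : 0 < ‖c - u‖ := norm_pos_iff.2 (sub_ne_zero.2 huc.symm)
      apply Real.log_nonneg
      rwa [← div_eq_mul_inv, one_le_div h0]
  · rw [Function.locallyFinsuppWithin.apply_eq_zero_of_notMem _ hu]
    simp

theorem circleIntegrable_norm_rpow {f : ℂ → ℂ} {c : ℂ} {R q : ℝ} (hq : 0 < q) (hR : 0 ≤ R)
    (hf : ContinuousOn f (Metric.closedBall c R)) :
    CircleIntegrable (fun z => ‖f z‖ ^ q) c R :=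
  ((hf.mono Metric.sphere_subset_closedBall).norm.rpow_const
    fun _ _ => Or.inr hq.le).circleIntegrable hR

/-- The inequality log x ≤ x/e is an equality at x = e. Put x = |f|^q and average: the sub-mean
value property of log |f| gives q log |f(c)| ≤ e⁻¹ · average ≤ 1. So the passage from log |f| to
|f|^q is made at the single level e; other levels follow by scaling f. -/
theorem norm_rpow_le_exp_one_of_circleAverage_le {f : ℂ → ℂ} {c : ℂ} {R q : ℝ} (hq : 0 < q)
    (hR : 0 < R) (hf : AnalyticOnNhd ℂ f (Metric.closedBall c R))
    (h : Real.circleAverage (fun z => ‖f z‖ ^ q) c R ≤ Real.exp 1) :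
    ‖f c‖ ^ q ≤ Real.exp 1 := by
  by_cases hc : f c = 0
  · simp [hc, Real.zero_rpow hq.ne', Real.exp_nonneg]
  have hlog := log_norm_le_circleAverage hR hf hc
  have hpos : 0 < ‖f c‖ := norm_pos_iff.2 hc
  have hfm : MeromorphicOn f (Metric.sphere c |R|) := by
    rw [abs_of_pos hR]
    exact (hf.mono Metric.sphere_subset_closedBall).meromorphicOn
  have h1 : Real.circleAverage (fun z => q • Real.log ‖f z‖) c R ≤
      Real.circleAverage (fun z => (Real.exp 1)⁻¹ • ‖f z‖ ^ q) c R := by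
    refine Real.circleAverage_mono ?_ ?_ fun z _ => ?_
    · exact (MeromorphicOn.circleIntegrable_log_norm hfm).const_smul
    · exact (circleIntegrable_norm_rpow hq hR.le hf.continuousOn).const_smul
    · simp only [smul_eq_mul]
      -- At a zero of `f` both sides vanish, as `Real.log 0 = 0`.
      rcases eq_or_ne (f z) 0 with hz | hz
      · simp [hz, Real.zero_rpow hq.ne']
      · have hz' : 0 < ‖f z‖ := norm_pos_iff.2 hz
        have h2 := Real.log_le_sub_one_of_pos
          (mul_pos (inv_pos.2 (Real.exp_pos 1)) (Real.rpow_pos_of_pos hz' q))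
        rw [Real.log_mul (by positivity) (by positivity), Real.log_inv, Real.log_exp,
          Real.log_rpow hz'] at h2
        linarith
  rw [Real.circleAverage_fun_smul, Real.circleAverage_fun_smul, smul_eq_mul, smul_eq_mul] at h1
  have h3 : (Real.exp 1)⁻¹ * Real.circleAverage (fun z => ‖f z‖ ^ q) c R ≤ 1 := by
    rw [inv_mul_le_iff₀ (Real.exp_pos 1), mul_one]
    exact h
  rw [← Real.log_le_iff_le_exp (by positivity), Real.log_rpow hpos]
  nlinarith

/-- `|f| ^ q` has the sub-mean value property. -/
theorem norm_rpow_le_circleAverage {f : ℂ → ℂ} {c : ℂ} {R q : ℝ} (hq : 0 < q)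
    (hR : 0 < R) (hf : AnalyticOnNhd ℂ f (Metric.closedBall c R)) :
    ‖f c‖ ^ q ≤ Real.circleAverage (fun z => ‖f z‖ ^ q) c R := by
  have h0 : 0 ≤ Real.circleAverage (fun z => ‖f z‖ ^ q) c R :=
    Real.circleAverage_nonneg_of_nonneg fun z _ => by positivity
  -- The average may be 0, so the scaling uses any M strictly above it: f is multiplied by K with
  -- K^q = e/M, which brings the average below e.
  refine le_of_forall_gt_imp_ge_of_dense fun M hM => ?_
  have hM0 : 0 < M := h0.trans_lt hM
  have he := Real.exp_pos 1
  set K : ℝ := (Real.exp 1 / M) ^ (1 / q)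
  have hK : 0 ≤ K := by positivity
  have hKq : K ^ q = Real.exp 1 / M := by
    rw [← Real.rpow_mul (by positivity), one_div_mul_cancel hq.ne', Real.rpow_one]
  have hscale : ∀ z, ‖(K : ℂ) * f z‖ ^ q = (Real.exp 1 / M) • ‖f z‖ ^ q := fun z => by
    rw [norm_mul, Complex.norm_real, Real.norm_of_nonneg hK, Real.mul_rpow hK (norm_nonneg _), hKq,
      smul_eq_mul]
  have key := norm_rpow_le_exp_one_of_circleAverage_le (f := fun z => (K : ℂ) * f z) hq hR
    (analyticOnNhd_const.mul hf) (by
      simp_rw [hscale]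
      rw [Real.circleAverage_fun_smul, smul_eq_mul, div_mul_eq_mul_div, div_le_iff₀ hM0]
      exact mul_le_mul_of_nonneg_left hM.le he.le)
  simp only [hscale, smul_eq_mul] at key
  rw [div_mul_eq_mul_div, div_le_iff₀ hM0] at key
  exact le_of_mul_le_mul_left key he

theorem circleAverage_zero_eq_integral_mul_exp (u : ℂ → ℝ) (ζ : ℂ) :
    Real.circleAverage u 0 ‖ζ‖ =
      (2 * Real.pi)⁻¹ * ∫ θ in (0 : ℝ)..(2 * Real.pi), u (ζ * Complex.exp (θ * Complex.I)) := by
  rw [Real.circleAverage_eq_integral_add ζ.arg, smul_eq_mul]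
  congr 2
  funext θ
  rw [circleMap_zero]
  conv_rhs => rw [← Complex.norm_mul_exp_arg_mul_I ζ]
  push_cast
  rw [mul_assoc, ← Complex.exp_add]
  congr 3
  ring

/-- The circular means of a function with the sub-mean value property again have the sub-mean
value property. -/
theorem circleAverage_zero_le_circleAverage {u : ℂ → ℝ} (hu : ContinuousOn u (Metric.ball 0 1))
    (hsub : ∀ (c : ℂ) (ρ : ℝ), 0 < ρ → ‖c‖ + ρ < 1 → u c ≤ Real.circleAverage u c ρ)
    {s ρ : ℝ} (hs : 0 ≤ s) (hρ : 0 < ρ) (h1 : s + ρ < 1) :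
    Real.circleAverage u 0 s ≤
      Real.circleAverage (fun z => Real.circleAverage u 0 ‖z‖) s ρ := by
  have hpi := Real.two_pi_pos
  have hns : ‖(s : ℂ)‖ = s := by rw [Complex.norm_real, Real.norm_of_nonneg hs]
  have hcm : ∀ α : ℝ, ‖circleMap (s : ℂ) ρ α‖ < 1 := fun α => by
    refine lt_of_le_of_lt ?_ h1
    rw [circleMap]
    refine (norm_add_le _ _).trans ?_
    rw [hns, norm_mul, Complex.norm_exp_ofReal_mul_I, Complex.norm_real, Real.norm_of_nonneg hρ.le,
      mul_one]
  have hcont : Continuous (fun x : ℝ × ℝ =>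
      u (circleMap s ρ x.2 * Complex.exp (x.1 * Complex.I))) := by
    refine hu.comp_continuous (by simp only [circleMap]; fun_prop) fun x => ?_
    rw [mem_ball_zero_iff, norm_mul, Complex.norm_exp_ofReal_mul_I, mul_one]
    exact hcm _
  have hpt : ∀ θ : ℝ, u (s * Complex.exp (θ * Complex.I)) ≤ (2 * Real.pi)⁻¹ *
      ∫ α in (0 : ℝ)..(2 * Real.pi), u (circleMap s ρ α * Complex.exp (θ * Complex.I)) := by
    intro θ
    refine (hsub _ ρ hρ ?_).trans_eq ?_
    · rwa [norm_mul, Complex.norm_exp_ofReal_mul_I, mul_one, hns]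
    -- Started at angle θ, the circle about s·e^(iθ) is the rotation by θ of the circle about s;
    -- Fubini can then exchange the two angles.
    · rw [Real.circleAverage_eq_integral_add θ, smul_eq_mul]
      congr 2
      funext α
      simp only [circleMap]
      push_cast
      rw [add_mul, add_mul, Complex.exp_add, mul_assoc (ρ : ℂ)]
  have hswap : (∫ θ in (0 : ℝ)..(2 * Real.pi), ∫ α in (0 : ℝ)..(2 * Real.pi),
        u (circleMap s ρ α * Complex.exp (θ * Complex.I))) =
      ∫ α in (0 : ℝ)..(2 * Real.pi), ∫ θ in (0 : ℝ)..(2 * Real.pi),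
        u (circleMap s ρ α * Complex.exp (θ * Complex.I)) := by
    refine intervalIntegral_intervalIntegral_swap ?_
    refine IntegrableOn.mono_set ?_ (Set.prod_mono uIoc_subset_uIcc uIoc_subset_uIcc)
    exact hcont.continuousOn.integrableOn_compact (isCompact_uIcc.prod isCompact_uIcc)
  have hleft := circleAverage_zero_eq_integral_mul_exp u s
  rw [hns] at hleft
  rw [hleft, Real.circleAverage_def, smul_eq_mul]
  refine mul_le_mul_of_nonneg_left ?_ (by positivity)
  simp_rw [circleAverage_zero_eq_integral_mul_exp u (circleMap _ _ _)]
  rw [intervalIntegral.integral_const_mul, ← hswap, ← intervalIntegral.integral_const_mul]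
  refine intervalIntegral.integral_mono_on hpi.le ?_ ?_ fun θ _ => hpt θ
  · refine (hu.comp_continuous (by fun_prop) fun θ => ?_).intervalIntegrable _ _
    rw [mem_ball_zero_iff, norm_mul, Complex.norm_exp_ofReal_mul_I, mul_one, hns]
    linarith
  · refine Continuous.intervalIntegrable (continuous_const.mul ?_) _ _
    exact intervalIntegral.continuous_parametric_intervalIntegral_of_continuous' hcont _ _

/-- The circular means of a function with the sub-mean value property are increasing. -/
theorem circleAverage_zero_mono {u : ℂ → ℝ} (hu : ContinuousOn u (Metric.ball 0 1))
    (hsub : ∀ (c : ℂ) (ρ : ℝ), 0 < ρ → ‖c‖ + ρ < 1 → u c ≤ Real.circleAverage u c ρ)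
    {r R : ℝ} (hr : 0 ≤ r) (hrR : r ≤ R) (hR : R < 1) :
    Real.circleAverage u 0 r ≤ Real.circleAverage u 0 R := by
  set U : ℝ → ℝ := Real.circleAverage u 0
  have hU : ContinuousOn U (Ico 0 1) :=
    Real.ContinuousOn.circleAverage (hu.mono fun z hz => by simpa using hz.2) fun r hr => hr.1
  have hUI : ContinuousOn U (Icc 0 R) := hU.mono fun x hx => ⟨hx.1, hx.2.trans_lt hR⟩
  obtain ⟨x₁, hx₁, hmax⟩ := isCompact_Icc.exists_isMaxOn ⟨r, hr, hrR⟩ hUI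
  have hK : IsCompact (Icc 0 R ∩ U ⁻¹' {U x₁}) :=
    isCompact_Icc.of_isClosed_subset (hUI.preimage_isClosed_of_isClosed isClosed_Icc
      isClosed_singleton) inter_subset_left
  -- Maximum principle: take the largest maximum point x₀ of U on [0, R]. If x₀ < R, the circle
  -- about x₀ of radius R - x₀ stays in the disc of radius R and touches its boundary at R, where U
  -- is strictly smaller. The average of U(|z|) over it is then below U(x₀), against the sub-mean
  -- value property.
  obtain ⟨x₀, ⟨hx₀, hx₀m⟩, hgr⟩ := hK.exists_isGreatest ⟨x₁, hx₁, rfl⟩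
  have hx₀m : U x₀ = U x₁ := hx₀m
  have hle : ∀ x ∈ Icc 0 R, U x ≤ U x₀ := fun x hx => hx₀m ▸ hmax hx
  rcases hx₀.2.eq_or_lt with h | h
  · exact h ▸ hle r ⟨hr, hrR⟩
  exfalso
  have hlt : U R < U x₀ := by
    have hRm : R ∈ Icc 0 R := ⟨hr.trans hrR, le_rfl⟩
    refine lt_of_le_of_ne (hle R hRm) fun hne => ?_
    exact absurd (hgr ⟨hRm, hne.trans hx₀m⟩) (not_le.2 h)
  have hbd : ∀ α : ℝ, ‖circleMap (x₀ : ℂ) (R - x₀) α‖ ∈ Icc 0 R := fun α => by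
    refine ⟨norm_nonneg _, ?_⟩
    rw [circleMap]
    refine (norm_add_le _ _).trans ?_
    rw [norm_mul, Complex.norm_exp_ofReal_mul_I, Complex.norm_real,
      Complex.norm_real, Real.norm_of_nonneg hx₀.1, Real.norm_of_nonneg (sub_nonneg.2 hx₀.2)]
    linarith
  have hsm := circleAverage_zero_le_circleAverage hu hsub hx₀.1 (sub_pos.2 h) (by linarith)
  have hst : Real.circleAverage (fun z => U ‖z‖) x₀ (R - x₀) < U x₀ := by
    rw [← Real.circleAverage_const (U x₀) (x₀ : ℂ) (R - x₀), Real.circleAverage_def,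
      Real.circleAverage_def, smul_eq_mul, smul_eq_mul]
    refine mul_lt_mul_of_pos_left ?_ (by positivity)
    refine intervalIntegral.integral_lt_integral_of_continuousOn_of_le_of_exists_lt
      Real.two_pi_pos ?_ continuousOn_const (fun α _ => hle _ (hbd α))
      ⟨0, ⟨le_rfl, Real.two_pi_pos.le⟩, ?_⟩
    · exact (hUI.comp_continuous (continuous_circleMap _ _).norm hbd).continuousOn
    · simpa [circleMap, abs_of_nonneg (hr.trans hrR)] using hlt
  exact absurd hsm (not_le.2 hst)

theorem discAnalytic_analyticOnNhd {f : ℂ → ℂ} (hf : f ∈ discAnalytic) :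
    AnalyticOnNhd ℂ f (Metric.ball 0 1) :=
  hf.1.analyticOnNhd Metric.isOpen_ball

theorem norm_rpow_le_circleAverage_of_mem_discAnalytic {f : ℂ → ℂ} (hf : f ∈ discAnalytic) {q : ℝ}
    (hq : 0 < q) {c : ℂ} {ρ : ℝ} (hρ : 0 < ρ) (h : ‖c‖ + ρ < 1) :
    ‖f c‖ ^ q ≤ Real.circleAverage (fun z => ‖f z‖ ^ q) c ρ := by
  refine norm_rpow_le_circleAverage hq hρ ((discAnalytic_analyticOnNhd hf).mono fun z hz => ?_)
  rw [mem_closedBall_iff_norm] at hz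
  rw [mem_ball_zero_iff]
  have h2 := norm_add_le c (z - c)
  rw [add_sub_cancel] at h2
  linarith

theorem integralMean_eq_circleAverage (q : ℝ) (f : ℂ → ℂ) (r : ℝ) :
    integralMean q f r = Real.circleAverage (fun z => ‖f z‖ ^ q) 0 r ^ (1 / q) := by
  simp only [integralMean, Real.circleAverage_def, smul_eq_mul, circleMap_zero]

theorem integralMean_rpow {q : ℝ} (hq : 0 < q) (f : ℂ → ℂ) (r : ℝ) :
    integralMean q f r ^ q = Real.circleAverage (fun z => ‖f z‖ ^ q) 0 r := by
  rw [integralMean_eq_circleAverage, ← Real.rpow_mul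
    (Real.circleAverage_nonneg_of_nonneg fun z _ => by positivity), one_div_mul_cancel hq.ne',
    Real.rpow_one]

theorem integralMean_mono {f : ℂ → ℂ} (hf : f ∈ discAnalytic) {q : ℝ} (hq : 0 < q) {r R : ℝ}
    (hr : 0 ≤ r) (hrR : r ≤ R) (hR : R < 1) : integralMean q f r ≤ integralMean q f R := by
  rw [integralMean_eq_circleAverage, integralMean_eq_circleAverage]
  refine Real.rpow_le_rpow (Real.circleAverage_nonneg_of_nonneg fun z _ => by positivity) ?_
    (by positivity)
  exact circleAverage_zero_mono (hf.1.continuousOn.norm.rpow_const fun _ _ => Or.inr hq.le)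
    (fun c ρ hρ h => norm_rpow_le_circleAverage_of_mem_discAnalytic hf hq hρ h) hr hrR hR

/-! ### Point values against integral means -/

theorem lintegral_eq_lintegral_polar {F : ℂ → ℝ≥0∞} (hF : Measurable F) :
    ∫⁻ z, F z = ∫⁻ ρ in Ioi (0 : ℝ), ENNReal.ofReal ρ *
      ∫⁻ θ in Ioo (-Real.pi) Real.pi, F (circleMap 0 ρ θ) := by
  rw [← Complex.lintegral_comp_polarCoord_symm, polarCoord_target, Measure.volume_eq_prod,
    setLIntegral_prod]
  · refine lintegral_congr fun ρ => ?_
    simp only [smul_eq_mul]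
    rw [lintegral_const_mul' _ _ ENNReal.ofReal_ne_top]
    refine congrArg _ (lintegral_congr fun θ => ?_)
    rw [Complex.polarCoord_symm_apply, circleMap_zero, Complex.exp_mul_I]
    push_cast
    rfl
  · refine Measurable.aemeasurable ?_
    simp only [smul_eq_mul, Complex.polarCoord_symm_apply]
    fun_prop

theorem lintegral_circleMap_eq {u : ℂ → ℝ} {c : ℂ} {ρ : ℝ} (h0 : ∀ z, 0 ≤ u z)
    (hu : Continuous fun θ => u (circleMap c ρ θ)) :
    ∫⁻ θ in Ioo (-Real.pi) Real.pi, ENNReal.ofReal (u (circleMap c ρ θ)) =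
      ENNReal.ofReal (2 * Real.pi * Real.circleAverage u c ρ) := by
  have hpi := Real.pi_pos
  have hper : Function.Periodic (fun θ => u (circleMap c ρ θ)) (2 * Real.pi) := fun θ => by
    simp [periodic_circleMap c ρ θ]
  rw [restrict_Ioo_eq_restrict_Ioc, ← ofReal_integral_eq_lintegral_ofReal
    ((hu.integrableOn_Icc (a := -Real.pi) (b := Real.pi)).mono_set Ioc_subset_Icc_self)
    (ae_of_all _ fun _ => h0 _), ← intervalIntegral.integral_of_le (by linarith),
    Real.circleAverage_def, smul_eq_mul, mul_inv_cancel_left₀ (by positivity)]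
  have := hper.intervalIntegral_add_eq (-Real.pi) 0
  rw [show -Real.pi + 2 * Real.pi = Real.pi by ring, zero_add] at this
  rw [this]

theorem norm_circleMap_zero_of_pos {ρ : ℝ} (hρ : 0 < ρ) (θ : ℝ) : ‖circleMap 0 ρ θ‖ = ρ := by
  rw [norm_circleMap_zero, abs_of_pos hρ]

/-- A pointwise bound for an analytic function by its integral means. -/
theorem norm_rpow_le_circleAverage_zero {f : ℂ → ℂ} (hf : f ∈ discAnalytic) {q : ℝ} (hq : 0 < q)
    {w : ℂ} (hw : ‖w‖ < 1) :
    (1 - ‖w‖) * ‖f w‖ ^ q ≤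
      16 * Real.circleAverage (fun z => ‖f z‖ ^ q) 0 ((1 + ‖w‖) / 2) := by
  set u : ℂ → ℝ := fun z => ‖f z‖ ^ q with hu
  have hu0 : ∀ z, 0 ≤ u z := fun z => by positivity
  have hucont : ContinuousOn u (Metric.ball 0 1) :=
    hf.1.continuousOn.norm.rpow_const fun _ _ => Or.inr hq.le
  have hum : Measurable u := (discAnalytic_measurable hf).norm.pow_const q
  set δ : ℝ := (1 - ‖w‖) / 2 with hδ
  have hδ0 : 0 < δ := by rw [hδ]; linarith
  set J := Real.circleAverage u 0 ((1 + ‖w‖) / 2) with hJ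
  have hJ0 : 0 ≤ J := Real.circleAverage_nonneg_of_nonneg fun z _ => hu0 z
  have hpi := Real.pi_pos
  set V : ℂ → ℝ≥0∞ := fun z => ENNReal.ofReal (u z)
  have hVm : Measurable V := hum.ennreal_ofReal
  -- Sub-mean value property on the circles about w of radius in (δ/2, δ); the smaller circles are
  -- discarded, and the area integral is still at least a multiple of δ² u(w).
  have hlow : ENNReal.ofReal (δ / 2 * (2 * Real.pi * u w)) * ENNReal.ofReal (δ / 2) ≤
      ∫⁻ z in Metric.ball w δ, V z := by
    rw [← lintegral_indicator Metric.isOpen_ball.measurableSet,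
      ← lintegral_add_left_eq_self _ w, lintegral_eq_lintegral_polar
        (F := fun x => (Metric.ball w δ).indicator V (w + x))
        ((hVm.indicator Metric.isOpen_ball.measurableSet).comp (measurable_const_add w))]
    have hsub : Ioo (δ / 2) δ ⊆ Ioi 0 := fun x hx => (half_pos hδ0).trans hx.1
    refine le_trans ?_ (lintegral_mono_set hsub)
    calc _ = ∫⁻ ρ in Ioo (δ / 2) δ, ENNReal.ofReal (δ / 2 * (2 * Real.pi * u w)) := by
          rw [setLIntegral_const, Real.volume_Ioo, sub_half]
      _ ≤ _ := by
        refine setLIntegral_mono' measurableSet_Ioo fun ρ hρ => ?_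
        have hρ0 : 0 < ρ := hsub hρ
        have hin : ∀ θ, w + circleMap 0 ρ θ = circleMap w ρ θ := fun θ => by
          simp [circleMap]
        have hmem : ∀ θ, circleMap w ρ θ ∈ Metric.ball w δ := fun θ => by
          rw [mem_ball_iff_norm, ← hin, add_sub_cancel_left, norm_circleMap_zero_of_pos hρ0]
          exact hρ.2
        have hcov : ∀ θ, circleMap w ρ θ ∈ Metric.ball (0 : ℂ) 1 := fun θ => by
          have h1 := mem_ball_iff_norm.1 (hmem θ)
          have h2 := norm_add_le w (circleMap w ρ θ - w)
          rw [add_sub_cancel] at h2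
          rw [mem_ball_zero_iff]
          linarith
        have heq : (∫⁻ θ in Ioo (-Real.pi) Real.pi,
            (Metric.ball w δ).indicator V (w + circleMap 0 ρ θ)) =
            ENNReal.ofReal (2 * Real.pi * Real.circleAverage u w ρ) := by
          rw [← lintegral_circleMap_eq hu0 (hucont.comp_continuous (continuous_circleMap w ρ) hcov)]
          refine lintegral_congr fun θ => ?_
          rw [hin, indicator_of_mem (hmem θ)]
        rw [heq, ← ENNReal.ofReal_mul hρ0.le]
        refine ENNReal.ofReal_le_ofReal ?_
        have hsm : u w ≤ Real.circleAverage u w ρ :=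
          norm_rpow_le_circleAverage_of_mem_discAnalytic hf hq hρ0 (by linarith [hρ.2])
        have := hu0 w
        exact mul_le_mul hρ.1.le (mul_le_mul_of_nonneg_left hsm (by positivity)) (by positivity)
          hρ0.le
  -- The disc lies in the annulus of width 2δ about the circle |z| = |w|, whose outer radius is
  -- (1+|w|)/2. Monotone means bound the integral there by a multiple of δJ. Dividing δJ by δ²
  -- leaves a single factor 1/δ, which is the source of the exponent 1/q.
  have hup : ∫⁻ z in Metric.ball w δ, V z ≤
      ENNReal.ofReal (2 * Real.pi * J) * ENNReal.ofReal (2 * δ) := by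
    set A : Set ℂ := {z | ‖z‖ ∈ Ioo (‖w‖ - δ) (‖w‖ + δ)} with hA
    have hAm : MeasurableSet A := measurable_norm measurableSet_Ioo
    have hsub : Metric.ball w δ ⊆ A := fun z hz => by
      rw [mem_ball_iff_norm] at hz
      have := (abs_norm_sub_norm_le z w).trans_lt hz
      rw [abs_lt] at this
      exact ⟨by linarith [this.1], by linarith [this.2]⟩
    refine (lintegral_mono_set hsub).trans ?_
    rw [← lintegral_indicator hAm, lintegral_eq_lintegral_polar (hVm.indicator hAm)]
    calc _ ≤ ∫⁻ ρ in Ioi (0 : ℝ), (Ioo (‖w‖ - δ) (‖w‖ + δ)).indicator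
            (fun _ => ENNReal.ofReal (2 * Real.pi * J)) ρ := by
          refine setLIntegral_mono' measurableSet_Ioi fun ρ hρ => ?_
          have hρ0 : 0 < ρ := hρ
          by_cases hρA : ρ ∈ Ioo (‖w‖ - δ) (‖w‖ + δ)
          · have hρ1 : ρ ≤ (1 + ‖w‖) / 2 := by linarith [hρA.2]
            have hcov : ∀ θ, circleMap 0 ρ θ ∈ Metric.ball (0 : ℂ) 1 := fun θ => by
              rw [mem_ball_zero_iff, norm_circleMap_zero_of_pos hρ0]
              linarith
            rw [indicator_of_mem hρA]
            have heq : (∫⁻ θ in Ioo (-Real.pi) Real.pi, A.indicator V (circleMap 0 ρ θ)) =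
                ENNReal.ofReal (2 * Real.pi * Real.circleAverage u 0 ρ) := by
              rw [← lintegral_circleMap_eq hu0
                (hucont.comp_continuous (continuous_circleMap 0 ρ) hcov)]
              refine lintegral_congr fun θ => ?_
              rw [indicator_of_mem]
              rw [hA, mem_ofPred_eq, norm_circleMap_zero_of_pos hρ0]
              exact hρA
            rw [heq, ← ENNReal.ofReal_mul hρ0.le]
            refine ENNReal.ofReal_le_ofReal ?_
            have hmono : Real.circleAverage u 0 ρ ≤ J := circleAverage_zero_mono hucont
              (fun c ρ hρ h => norm_rpow_le_circleAverage_of_mem_discAnalytic hf hq hρ h)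
              hρ0.le hρ1 (by linarith)
            have h0 : 0 ≤ Real.circleAverage u 0 ρ :=
              Real.circleAverage_nonneg_of_nonneg fun z _ => hu0 z
            calc ρ * (2 * Real.pi * Real.circleAverage u 0 ρ)
                ≤ 1 * (2 * Real.pi * Real.circleAverage u 0 ρ) :=
                  mul_le_mul_of_nonneg_right (by linarith) (by positivity)
              _ ≤ 2 * Real.pi * J := by rw [one_mul]; gcongr
          · rw [indicator_of_notMem hρA]
            have : (∫⁻ θ in Ioo (-Real.pi) Real.pi, A.indicator V (circleMap 0 ρ θ)) = 0 := by
              rw [← lintegral_zero]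
              refine lintegral_congr fun θ => indicator_of_notMem (fun h => hρA ?_) _
              rwa [hA, mem_ofPred_eq, norm_circleMap_zero_of_pos hρ0] at h
            rw [this, mul_zero]
      _ ≤ ∫⁻ ρ, (Ioo (‖w‖ - δ) (‖w‖ + δ)).indicator
            (fun _ => ENNReal.ofReal (2 * Real.pi * J)) ρ := setLIntegral_le_lintegral _ _
      _ = _ := by
          rw [lintegral_indicator measurableSet_Ioo, setLIntegral_const, Real.volume_Ioo]
          congr 2
          ring
  have hfin := hlow.trans hup
  have := hu0 w
  rw [← ENNReal.ofReal_mul (by positivity), ← ENNReal.ofReal_mul (by positivity),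
    ENNReal.ofReal_le_ofReal_iff (by positivity)] at hfin
  have h2 : Real.pi * δ * (δ * u w) ≤ Real.pi * δ * (8 * J) := by linarith
  have h3 := le_of_mul_le_mul_left h2 (by positivity)
  rw [hδ] at h3
  linarith

/-! ### Normal functions and the growth of derivatives -/

/-- The two-sided growth bounds that a normal function satisfies. -/
structure NormalBounds (φ : ℝ → ℝ) (a b : ℝ) : Prop where
  continuousOn : ContinuousOn φ (Ico 0 1)
  pos : ∀ r ∈ Ico (0 : ℝ) 1, 0 < φ r
  exponent_pos : 0 < a
  exponent_lt : a < b
  le_mul_rpow : ∀ r t : ℝ, 0 ≤ r → r ≤ t → t < 1 → φ t ≤ φ r * ((1 - t) / (1 - r)) ^ a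
  mul_rpow_le : ∀ r t : ℝ, 0 ≤ r → r ≤ t → t < 1 → φ r * ((1 - t) / (1 - r)) ^ b ≤ φ t

theorem IsNormalFunction.exists_normalBounds {φ : ℝ → ℝ} (hφ : IsNormalFunction φ) :
    ∃ a b, NormalBounds φ a b := by
  obtain ⟨hc, hpos, a, b, ha, hab, hanti, -, hmono, -⟩ := hφ
  refine ⟨a, b, hc, hpos, ha, hab, fun r t hr hrt ht => ?_, fun r t hr hrt ht => ?_⟩
  · have h := hanti ⟨hr, hrt.trans_lt ht⟩ ⟨hr.trans hrt, ht⟩ hrt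
    have h1 : 0 < 1 - t := by linarith
    have h2 : 0 < 1 - r := by linarith
    simp only at h
    rw [div_le_iff₀ (by positivity)] at h
    rw [Real.div_rpow h1.le h2.le]
    exact h.trans_eq (by ring)
  · have h := hmono ⟨hr, hrt.trans_lt ht⟩ ⟨hr.trans hrt, ht⟩ hrt
    have h1 : 0 < 1 - t := by linarith
    have h2 : 0 < 1 - r := by linarith
    simp only at h
    rw [le_div_iff₀ (by positivity)] at h
    rw [Real.div_rpow h1.le h2.le]
    exact le_of_eq_of_le (by ring) h

theorem mixedNormPow_le_of_mixedNorm_le {p q : ℝ} (hp : 0 < p) {φ : ℝ → ℝ} {f : ℂ → ℂ} {A : ℝ}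
    (hA : 0 ≤ A) (h : mixedNorm p q φ f ≤ ENNReal.ofReal A) :
    mixedNormPow p q φ f ≤ ENNReal.ofReal (A ^ p) := by
  have h1 := ENNReal.rpow_le_rpow h hp.le
  rwa [mixedNorm, ← ENNReal.rpow_mul, one_div_mul_cancel hp.ne', ENNReal.rpow_one,
    ENNReal.ofReal_rpow_of_nonneg hA hp.le] at h1

theorem mixedNorm_le_of_mixedNormPow_le {p q : ℝ} (hp : 0 < p) {φ : ℝ → ℝ} {f : ℂ → ℂ} {A : ℝ}
    (hA : 0 ≤ A) (h : mixedNormPow p q φ f ≤ ENNReal.ofReal A) :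
    mixedNorm p q φ f ≤ ENNReal.ofReal (A ^ (1 / p)) := by
  have hp' : 0 ≤ 1 / p := by positivity
  rw [← ENNReal.ofReal_rpow_of_nonneg hA hp']
  exact ENNReal.rpow_le_rpow h hp'

/-- Restrict the norm integral to (r, (1+r)/2). There M_q(f,t) ≥ M_q(f,r), φ(t) ≥ 2^(-b) φ(r) and
1/(1-t) ≥ 1/(1-r), while the interval has length (1-r)/2, so the factors 1-r cancel. -/
theorem NormalBounds.integralMean_le {p q : ℝ} (hp : 0 < p) (hq : 0 < q) {φ : ℝ → ℝ} {a b : ℝ}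
    (hφ : NormalBounds φ a b) {f : ℂ → ℂ} (hf : f ∈ discAnalytic) {A : ℝ} (hA : 0 ≤ A)
    (h : mixedNorm p q φ f ≤ ENNReal.ofReal A) {r : ℝ} (hr : r ∈ Ico (0 : ℝ) 1) :
    integralMean q f r * φ r ≤ 2 ^ b * 2 ^ (1 / p) * A := by
  have hpow := mixedNormPow_le_of_mixedNorm_le hp hA h
  have hφr := hφ.pos r hr
  have hb : 0 < b := hφ.exponent_pos.trans hφ.exponent_lt
  have h1r : 0 < 1 - r := by linarith [hr.2]
  set M := integralMean q f r with hM
  have hM0 : 0 ≤ M := integralMean_nonneg q f r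
  have hsub : Ioo r ((1 + r) / 2) ⊆ Ioo 0 1 := fun t ht =>
    ⟨hr.1.trans_lt ht.1, by linarith [ht.2, hr.2]⟩
  set X := M * (φ r * (1 / 2) ^ b) with hX
  have hX0 : 0 ≤ X := by positivity
  have hlow : ENNReal.ofReal (X ^ p / (1 - r)) * ENNReal.ofReal ((1 - r) / 2) ≤
      mixedNormPow p q φ f := by
    refine le_trans ?_ (lintegral_mono_set hsub)
    calc _ = ∫⁻ t in Ioo r ((1 + r) / 2), ENNReal.ofReal (X ^ p / (1 - r)) := by
          rw [setLIntegral_const, Real.volume_Ioo]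
          congr 2
          ring
      _ ≤ _ := by
        refine setLIntegral_mono' measurableSet_Ioo fun t ht => ENNReal.ofReal_le_ofReal ?_
        have ht1 : 0 < 1 - t := by linarith [(hsub ht).2]
        rw [← mul_div_assoc, ← Real.mul_rpow (integralMean_nonneg _ _ _)
          (hφ.pos t (Ioo_subset_Ico_self (hsub ht))).le]
        have hMt : M ≤ integralMean q f t := integralMean_mono hf hq hr.1 ht.1.le (hsub ht).2
        have hφt : φ r * (1 / 2) ^ b ≤ φ t := by
          refine le_trans ?_ (hφ.mul_rpow_le r t hr.1 ht.1.le (hsub ht).2)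
          refine mul_le_mul_of_nonneg_left (Real.rpow_le_rpow (by norm_num) ?_ hb.le) hφr.le
          rw [le_div_iff₀ h1r]
          linarith [ht.2]
        have hXt : X ≤ integralMean q f t * φ t :=
          mul_le_mul hMt hφt (by positivity) (integralMean_nonneg _ _ _)
        exact div_le_div₀ (Real.rpow_nonneg (hX0.trans hXt) _) (Real.rpow_le_rpow hX0 hXt hp.le)
          ht1 (by linarith [ht.1])
  have h2 := hlow.trans hpow
  rw [← ENNReal.ofReal_mul (by positivity), ENNReal.ofReal_le_ofReal_iff (by positivity)] at h2
  have h3 : X ^ p ≤ 2 * A ^ p := by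
    have : X ^ p / (1 - r) * ((1 - r) / 2) = X ^ p / 2 := by field_simp
    linarith
  have h4 : X ≤ 2 ^ (1 / p) * A := by
    have := Real.rpow_le_rpow (by positivity) h3 (by positivity : 0 ≤ 1 / p)
    rwa [Real.mul_rpow (x := 2) (by norm_num) (by positivity), ← Real.rpow_mul hX0, ← Real.rpow_mul hA,
      mul_one_div_cancel hp.ne', Real.rpow_one, Real.rpow_one] at this
  have h5 : M * φ r = 2 ^ b * X := by
    have h6 : (2 : ℝ) ^ b * (1 / 2) ^ b = 1 := by
      rw [← Real.mul_rpow (by norm_num) (by norm_num)]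
      norm_num
    rw [hX]
    linear_combination (-M * φ r) * h6
  rw [h5, mul_assoc]
  exact mul_le_mul_of_nonneg_left h4 (by positivity)

/-- The growth weight `φ(s) (1 - s) ^ (1/q + n)`: the reciprocal of the largest order of growth of
the `n`-th derivatives of functions in `H(p, q, φ)`. -/
noncomputable def growthWeight (q : ℝ) (φ : ℝ → ℝ) (n : ℕ) (s : ℝ) : ℝ :=
  φ s * (1 - s) ^ (1 / q + (n : ℝ))

theorem NormalBounds.antitoneOn {φ : ℝ → ℝ} {a b : ℝ} (hφ : NormalBounds φ a b) {r t : ℝ}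
    (hr : 0 ≤ r) (hrt : r ≤ t) (ht : t < 1) : φ t ≤ φ r := by
  refine (hφ.le_mul_rpow r t hr hrt ht).trans (mul_le_of_le_one_right
    (hφ.pos r ⟨hr, hrt.trans_lt ht⟩).le (Real.rpow_le_one ?_ ?_ hφ.exponent_pos.le))
  · exact div_nonneg (by linarith) (by linarith)
  · rw [div_le_one (by linarith)]
    linarith

theorem NormalBounds.growthWeight_pos {φ : ℝ → ℝ} {a b : ℝ} (hφ : NormalBounds φ a b) (q : ℝ)
    (n : ℕ) {s : ℝ} (h0 : 0 ≤ s) (h1 : s < 1) : 0 < growthWeight q φ n s :=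
  mul_pos (hφ.pos s ⟨h0, h1⟩) (Real.rpow_pos_of_pos (by linarith) _)

theorem NormalBounds.growthWeight_anti {φ : ℝ → ℝ} {a b : ℝ} (hφ : NormalBounds φ a b) {q : ℝ}
    (hq : 0 < q) (n : ℕ) {r t : ℝ} (hr : 0 ≤ r) (hrt : r ≤ t) (ht : t < 1) :
    growthWeight q φ n t ≤ growthWeight q φ n r :=
  mul_le_mul (hφ.antitoneOn hr hrt ht)
    (Real.rpow_le_rpow (by linarith) (by linarith) (by positivity))
    (Real.rpow_nonneg (by linarith) _) (hφ.pos r ⟨hr, hrt.trans_lt ht⟩).le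

theorem growthWeight_eq_mul_pow {q : ℝ} {φ : ℝ → ℝ} (n : ℕ) {s : ℝ} (hs : s < 1) :
    growthWeight q φ n s = growthWeight q φ 0 s * (1 - s) ^ n := by
  simp only [growthWeight]
  rw [Real.rpow_add (by linarith), Real.rpow_natCast, Nat.cast_zero, add_zero, mul_assoc]

/-- The point value at w is bounded by M_q at radius (1+|w|)/2, and that mean by the norm; moving φ
from this radius back to |w| costs another 2^b. -/
theorem NormalBounds.norm_mul_growthWeight_le {p q : ℝ} (hp : 0 < p) (hq : 0 < q) {φ : ℝ → ℝ}
    {a b : ℝ} (hφ : NormalBounds φ a b) {f : ℂ → ℂ} (hf : f ∈ discAnalytic) {A : ℝ} (hA : 0 ≤ A)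
    (h : mixedNorm p q φ f ≤ ENNReal.ofReal A) {w : ℂ} (hw : ‖w‖ < 1) :
    ‖f w‖ * growthWeight q φ 0 ‖w‖ ≤ 16 ^ (1 / q) * (2 ^ b * (2 ^ b * 2 ^ (1 / p))) * A := by
  have hw0 := norm_nonneg w
  have hb : 0 < b := hφ.exponent_pos.trans hφ.exponent_lt
  have h1w : 0 < 1 - ‖w‖ := by linarith
  have hr : (1 + ‖w‖) / 2 ∈ Ico (0 : ℝ) 1 := ⟨by positivity, by linarith⟩
  have h1 := norm_rpow_le_circleAverage_zero hf hq hw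
  rw [← integralMean_rpow hq] at h1
  set M := integralMean q f ((1 + ‖w‖) / 2)
  have hM0 : 0 ≤ M := integralMean_nonneg _ _ _
  have h2 : (1 - ‖w‖) ^ (1 / q) * ‖f w‖ ≤ 16 ^ (1 / q) * M := by
    have := Real.rpow_le_rpow (by positivity) h1 (by positivity : 0 ≤ 1 / q)
    rwa [Real.mul_rpow h1w.le (by positivity), Real.mul_rpow (by norm_num) (by positivity),
      ← Real.rpow_mul (norm_nonneg _), ← Real.rpow_mul hM0, mul_one_div_cancel hq.ne',
      Real.rpow_one, Real.rpow_one] at this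
  have h3 := hφ.integralMean_le hp hq hf hA h hr
  have h4 : φ ‖w‖ ≤ 2 ^ b * φ ((1 + ‖w‖) / 2) := by
    have h5 := hφ.mul_rpow_le ‖w‖ ((1 + ‖w‖) / 2) hw0 (by linarith) hr.2
    have h6 : (1 - (1 + ‖w‖) / 2) / (1 - ‖w‖) = 1 / 2 := by
      field_simp
      ring
    have h7 : (2 : ℝ) ^ b * (1 / 2) ^ b = 1 := by
      rw [← Real.mul_rpow (by norm_num) (by norm_num)]
      norm_num
    rw [h6] at h5
    calc φ ‖w‖ = 2 ^ b * (φ ‖w‖ * (1 / 2) ^ b) := by linear_combination (-φ ‖w‖) * h7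
      _ ≤ _ := mul_le_mul_of_nonneg_left h5 (by positivity)
  have hφw := hφ.pos ‖w‖ ⟨hw0, hw⟩
  have hφr := hφ.pos _ hr
  calc ‖f w‖ * growthWeight q φ 0 ‖w‖ = φ ‖w‖ * ((1 - ‖w‖) ^ (1 / q) * ‖f w‖) := by
        simp only [growthWeight, Nat.cast_zero, add_zero]
        ring
    _ ≤ (2 ^ b * φ ((1 + ‖w‖) / 2)) * (16 ^ (1 / q) * M) :=
        mul_le_mul h4 h2 (by positivity) (by positivity)
    _ = 16 ^ (1 / q) * (2 ^ b * (M * φ ((1 + ‖w‖) / 2))) := by ring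
    _ ≤ 16 ^ (1 / q) * (2 ^ b * (2 ^ b * 2 ^ (1 / p) * A)) := by gcongr
    _ = _ := by ring

/-- The sharp growth estimate for the derivatives of functions in `H(p, q, φ)`. -/
theorem NormalBounds.exists_norm_iteratedDeriv_mul_growthWeight_le {p q : ℝ} (hp : 0 < p)
    (hq : 0 < q) {φ : ℝ → ℝ} {a b : ℝ} (hφ : NormalBounds φ a b) (n : ℕ) :
    ∃ C : ℝ, 0 < C ∧ ∀ f ∈ discAnalytic, ∀ A : ℝ, 0 ≤ A →
      mixedNorm p q φ f ≤ ENNReal.ofReal A → ∀ w : ℂ, ‖w‖ < 1 →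
        ‖iteratedDeriv n f w‖ * growthWeight q φ n ‖w‖ ≤ C * A := by
  set K : ℝ := 16 ^ (1 / q) * (2 ^ b * (2 ^ b * 2 ^ (1 / p))) with hK
  have hK0 : 0 < K := by positivity
  refine ⟨n.factorial * (2 ^ b * 2 ^ (1 / q) * K) * 2 ^ n, by positivity, ?_⟩
  intro f hf A hA h w hw
  have hw0 := norm_nonneg w
  have h1w : 0 < 1 - ‖w‖ := by linarith
  set r := (1 + ‖w‖) / 2 with hr
  set δ := (1 - ‖w‖) / 2 with hδ
  have hδ0 : 0 < δ := by positivity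
  have hr1 : r < 1 := by linarith
  have hGr := hφ.growthWeight_pos q 0 (show 0 ≤ r by positivity) hr1
  have hGw := hφ.growthWeight_pos q 0 hw0 hw
  have hz : ∀ z, ‖z - w‖ ≤ δ → ‖z‖ ≤ r := fun z hz => by
    have h2 := norm_add_le w (z - w)
    rw [add_sub_cancel] at h2
    linarith
  -- Cauchy's estimate on the circle of radius δ = (1-|w|)/2 about w: it stays in |z| ≤ r, where the
  -- weight for n = 0 is at least its value at r, and `hG` compares that value with the one at |w|.
  have hC := Complex.norm_iteratedDeriv_le_of_forall_mem_sphere_norm_le (f := f) (c := w) n hδ0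
    (C := K * A / growthWeight q φ 0 r) (by
      refine DifferentiableOn.diffContOnCl (hf.1.mono fun z hz' => ?_)
      rw [closure_ball _ hδ0.ne', mem_closedBall_iff_norm] at hz'
      rw [mem_ball_zero_iff]
      exact (hz z hz').trans_lt hr1) (fun z hz' => by
      rw [mem_sphere_iff_norm] at hz'
      have hzr := hz z hz'.le
      rw [le_div_iff₀ hGr]
      refine le_trans ?_ (hφ.norm_mul_growthWeight_le hp hq hf hA h (hzr.trans_lt hr1))
      exact mul_le_mul_of_nonneg_left (hφ.growthWeight_anti hq 0 (norm_nonneg _) hzr hr1)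
        (norm_nonneg _))
  have hG : growthWeight q φ 0 ‖w‖ ≤ 2 ^ b * 2 ^ (1 / q) * growthWeight q φ 0 r := by
    have h5 := hφ.mul_rpow_le ‖w‖ r hw0 (by linarith) hr1
    have h6 : (1 - r) / (1 - ‖w‖) = 1 / 2 := by
      rw [hr]
      field_simp
      ring
    have h7 : (2 : ℝ) ^ b * (1 / 2) ^ b = 1 := by
      rw [← Real.mul_rpow (by norm_num) (by norm_num)]
      norm_num
    have h8 : (1 - ‖w‖) = 2 * (1 - r) := by linarith
    rw [h6] at h5
    have h9 : φ ‖w‖ ≤ 2 ^ b * φ r := by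
      calc φ ‖w‖ = 2 ^ b * (φ ‖w‖ * (1 / 2) ^ b) := by linear_combination (-φ ‖w‖) * h7
        _ ≤ _ := mul_le_mul_of_nonneg_left h5 (by positivity)
    simp only [growthWeight, Nat.cast_zero, add_zero]
    rw [h8, Real.mul_rpow (by norm_num) (by linarith)]
    have h10 : 0 ≤ (1 - r) ^ (1 / q) := Real.rpow_nonneg (by linarith) _
    calc φ ‖w‖ * (2 ^ (1 / q) * (1 - r) ^ (1 / q))
        ≤ (2 ^ b * φ r) * (2 ^ (1 / q) * (1 - r) ^ (1 / q)) := by gcongr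
      _ = _ := by ring
  rw [growthWeight_eq_mul_pow n hw, show 1 - ‖w‖ = 2 * δ by rw [hδ]; ring, mul_pow]
  calc ‖iteratedDeriv n f w‖ * (growthWeight q φ 0 ‖w‖ * (2 ^ n * δ ^ n))
      ≤ (n.factorial * (K * A / growthWeight q φ 0 r) / δ ^ n) *
        ((2 ^ b * 2 ^ (1 / q) * growthWeight q φ 0 r) * (2 ^ n * δ ^ n)) := by gcongr
    _ = _ := by field_simp

/-! ### A criterion for membership in H(p,q,φ) -/

theorem indicator_ball_mem_discAnalytic {h : ℂ → ℂ} (hh : DifferentiableOn ℂ h (Metric.ball 0 1)) :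
    (Metric.ball (0 : ℂ) 1).indicator h ∈ discAnalytic :=
  ⟨hh.congr fun _ hz => indicator_of_mem hz _, fun _ hz => indicator_of_notMem hz _⟩

theorem iteratedDeriv_indicator_ball (h : ℂ → ℂ) (n : ℕ) {w : ℂ} (hw : ‖w‖ < 1) :
    iteratedDeriv n ((Metric.ball (0 : ℂ) 1).indicator h) w = iteratedDeriv n h w := by
  refine Filter.EventuallyEq.iteratedDeriv_eq n ?_
  filter_upwards [Metric.isOpen_ball.mem_nhds (mem_ball_zero_iff.2 hw)] with z hz
  exact indicator_of_mem hz _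

theorem integralMean_indicator_ball (q : ℝ) (h : ℂ → ℂ) {r : ℝ} (hr : r ∈ Ioo (0 : ℝ) 1) :
    integralMean q ((Metric.ball (0 : ℂ) 1).indicator h) r = integralMean q h r := by
  have : ∀ θ : ℝ, (r * Complex.exp (θ * Complex.I) : ℂ) ∈ Metric.ball (0 : ℂ) 1 := fun θ => by
    rw [mem_ball_zero_iff, norm_mul, Complex.norm_exp_ofReal_mul_I, mul_one, Complex.norm_real,
      Real.norm_of_nonneg hr.1.le]
    exact hr.2
  simp only [integralMean, indicator_of_mem (this _)]

theorem setLIntegral_one_sub_rpow_Ioo_one {m ρ : ℝ} (hm : 0 < m) (hρ : ρ < 1) :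
    ∫⁻ r in Ioo ρ 1, ENNReal.ofReal ((1 - r) ^ (m - 1)) = ENNReal.ofReal ((1 - ρ) ^ m / m) := by
  have hint : IntervalIntegrable (fun r : ℝ => (1 - r) ^ (m - 1)) volume ρ 1 := by
    have := (intervalIntegral.intervalIntegrable_rpow' (a := 0) (b := 1 - ρ)
      (by linarith : -1 < m - 1)).comp_sub_left 1
    simpa using this.symm
  rw [restrict_Ioo_eq_restrict_Ioc, ← ofReal_integral_eq_lintegral_ofReal
    ((intervalIntegrable_iff_integrableOn_Ioc_of_le hρ.le).1 hint),
    ← intervalIntegral.integral_of_le hρ.le,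
    intervalIntegral.integral_comp_sub_left (fun x : ℝ => x ^ (m - 1)) 1,
    integral_rpow (Or.inl (by linarith)), sub_self, sub_add_cancel, Real.zero_rpow hm.ne', sub_zero]
  exact ae_restrict_of_forall_mem measurableSet_Ioc fun r hr =>
    Real.rpow_nonneg (by linarith [hr.2]) _

theorem integral_rpow_neg_le {m x y : ℝ} (hm : 0 < m) (hx : 0 < x) (hxy : x ≤ y) :
    ∫ u in x..y, u ^ (-m - 1) ≤ x ^ (-m) / m := by
  rw [integral_rpow (Or.inr ⟨by linarith, fun h => by
    rw [uIcc_of_le hxy] at h; linarith [h.1]⟩), sub_add_cancel]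
  have := Real.rpow_nonneg (hx.le.trans hxy) (-m)
  rw [div_neg, ← neg_div]
  gcongr
  linarith

theorem setLIntegral_one_sub_rpow_Ioc_zero_le {m ρ : ℝ} (hm : 0 < m) (h0 : 0 ≤ ρ) (hρ : ρ < 1) :
    ∫⁻ r in Ioc 0 ρ, ENNReal.ofReal ((1 - r) ^ (-m - 1)) ≤
      ENNReal.ofReal ((1 - ρ) ^ (-m) / m) := by
  have hcont : ContinuousOn (fun r : ℝ => (1 - r) ^ (-m - 1)) (Icc 0 ρ) := by
    refine ContinuousOn.rpow_const (by fun_prop) fun r hr => Or.inl ?_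
    linarith [hr.2]
  rw [← ofReal_integral_eq_lintegral_ofReal (hcont.integrableOn_Icc.mono_set Ioc_subset_Icc_self),
    ← intervalIntegral.integral_of_le h0,
    intervalIntegral.integral_comp_sub_left (fun x : ℝ => x ^ (-m - 1)) 1, sub_zero]
  · exact ENNReal.ofReal_le_ofReal (integral_rpow_neg_le hm (by linarith) (by linarith))
  · exact ae_restrict_of_forall_mem measurableSet_Ioc fun r hr =>
      Real.rpow_nonneg (by linarith [hr.2]) _

/-- A sufficient condition for membership in `H(p, q, φ)`: the integral means grow at most like
those of the standard kernels. -/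
theorem NormalBounds.mixedNormPow_le_of_integralMean_le {p q : ℝ} (hp : 0 < p) {φ : ℝ → ℝ}
    {a b : ℝ} (hφ : NormalBounds φ a b) {f : ℂ → ℂ} {K t ρ : ℝ} (hK : 0 ≤ K) (ht : b < t)
    (h0 : 0 ≤ ρ) (hρ : ρ < 1)
    (h : ∀ r ∈ Ioo (0 : ℝ) 1,
      integralMean q f r ≤ K * ((1 - ρ) ^ t / φ ρ * (1 - ρ * r) ^ (-t))) :
    mixedNormPow p q φ f ≤ ENNReal.ofReal (K ^ p * (1 / ((t - b) * p) + 1 / (a * p))) := by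
  have ha := hφ.exponent_pos
  have hb : 0 < b := ha.trans hφ.exponent_lt
  have ht0 : 0 < t := hb.trans ht
  have hx : 0 < 1 - ρ := by linarith
  have hφρ := hφ.pos ρ ⟨h0, hρ⟩
  have hprod : ∀ r ∈ Ioo (0 : ℝ) 1, 1 - r ≤ 1 - ρ * r ∧ 1 - ρ ≤ 1 - ρ * r := fun r hr =>
    ⟨by nlinarith [hr.1], by nlinarith [hr.2]⟩
  have hstep : ∀ r ∈ Ioo (0 : ℝ) 1, ∀ B : ℝ,
      (1 - ρ) ^ t / φ ρ * (1 - ρ * r) ^ (-t) * φ r ≤ B →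
      ENNReal.ofReal (integralMean q f r ^ p * (φ r ^ p / (1 - r))) ≤
        ENNReal.ofReal (K ^ p) * ENNReal.ofReal (B ^ p / (1 - r)) := by
    intro r hr B hB
    have h1r : 0 < 1 - r := by linarith [hr.2]
    have hφr := hφ.pos r (Ioo_subset_Ico_self hr)
    have hM := integralMean_nonneg q f r
    rw [← ENNReal.ofReal_mul (by positivity)]
    refine ENNReal.ofReal_le_ofReal ?_
    rw [← mul_div_assoc, ← mul_div_assoc, ← Real.mul_rpow hM hφr.le]
    have hle : integralMean q f r * φ r ≤ K * B := by
      calc integralMean q f r * φ r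
          ≤ K * ((1 - ρ) ^ t / φ ρ * (1 - ρ * r) ^ (-t)) * φ r :=
            mul_le_mul_of_nonneg_right (h r hr) hφr.le
        _ = K * ((1 - ρ) ^ t / φ ρ * (1 - ρ * r) ^ (-t) * φ r) := by ring
        _ ≤ K * B := mul_le_mul_of_nonneg_left hB hK
    have hB0 : 0 ≤ B := by
      have h2 : 0 < 1 - ρ * r := hx.trans_le (hprod r hr).2
      exact le_trans (by positivity) hB
    rw [← Real.mul_rpow hK hB0]
    gcongr
  -- For r ≤ ρ use 1 - ρr ≥ 1 - r and the exponent b of φ. The integrand is a power of 1-r below -1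
  -- because t > b, so the integral is governed by its value at ρ.
  have hleft : ∫⁻ r in Ioc 0 ρ, ENNReal.ofReal (integralMean q f r ^ p * (φ r ^ p / (1 - r))) ≤
      ENNReal.ofReal (K ^ p) * ENNReal.ofReal (1 / ((t - b) * p)) := by
    have hm : 0 < (t - b) * p := mul_pos (by linarith) hp
    calc _ ≤ ∫⁻ r in Ioc 0 ρ, ENNReal.ofReal (K ^ p) * (ENNReal.ofReal ((1 - ρ) ^ ((t - b) * p)) *
            ENNReal.ofReal ((1 - r) ^ (-((t - b) * p) - 1))) := by
          refine setLIntegral_mono' measurableSet_Ioc fun r hr => ?_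
          have hr' : r ∈ Ioo (0 : ℝ) 1 := ⟨hr.1, hr.2.trans_lt hρ⟩
          have h1r : 0 < 1 - r := by linarith [hr'.2]
          have hφr := hφ.pos r (Ioo_subset_Ico_self hr')
          refine (hstep r hr' ((1 - ρ) ^ (t - b) * (1 - r) ^ (-(t - b))) ?_).trans_eq ?_
          · have h1 : φ r ≤ φ ρ * ((1 - r) ^ b / (1 - ρ) ^ b) := by
              have := hφ.mul_rpow_le r ρ hr.1.le hr.2 hρ
              rw [Real.div_rpow hx.le h1r.le, ← mul_div_assoc,
                div_le_iff₀ (by positivity)] at this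
              rw [← mul_div_assoc, le_div_iff₀ (by positivity)]
              exact this
            have h2 : (1 - ρ * r) ^ (-t) ≤ (1 - r) ^ (-t) :=
              Real.rpow_le_rpow_of_nonpos h1r (hprod r hr').1 (by linarith)
            calc (1 - ρ) ^ t / φ ρ * (1 - ρ * r) ^ (-t) * φ r
                ≤ (1 - ρ) ^ t / φ ρ * (1 - r) ^ (-t) *
                  (φ ρ * ((1 - r) ^ b / (1 - ρ) ^ b)) := by gcongr
              _ = ((1 - ρ) ^ t / (1 - ρ) ^ b) * ((1 - r) ^ (-t) * (1 - r) ^ b) := by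
                  field_simp
              _ = _ := by
                  rw [← Real.rpow_sub hx, ← Real.rpow_add h1r]
                  congr 2
                  ring
          · rw [← ENNReal.ofReal_mul (p := (1 - ρ) ^ ((t - b) * p)) (by positivity)]
            congr 2
            rw [Real.mul_rpow (by positivity) (by positivity), ← Real.rpow_mul hx.le,
              ← Real.rpow_mul h1r.le, Real.rpow_sub_one h1r.ne', neg_mul, mul_div_assoc]
      _ = ENNReal.ofReal (K ^ p) * (ENNReal.ofReal ((1 - ρ) ^ ((t - b) * p)) *
            ∫⁻ r in Ioc 0 ρ, ENNReal.ofReal ((1 - r) ^ (-((t - b) * p) - 1))) := by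
          rw [lintegral_const_mul' _ _ ENNReal.ofReal_ne_top,
            lintegral_const_mul' _ _ ENNReal.ofReal_ne_top]
      _ ≤ ENNReal.ofReal (K ^ p) * (ENNReal.ofReal ((1 - ρ) ^ ((t - b) * p)) *
            ENNReal.ofReal ((1 - ρ) ^ (-((t - b) * p)) / ((t - b) * p))) := by
          gcongr
          exact setLIntegral_one_sub_rpow_Ioc_zero_le hm h0 hρ
      _ = _ := by
          rw [← ENNReal.ofReal_mul (p := (1 - ρ) ^ ((t - b) * p)) (by positivity),
            ← mul_div_assoc, ← Real.rpow_add hx, add_neg_cancel, Real.rpow_zero]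
  -- For r > ρ use 1 - ρr ≥ 1 - ρ and the exponent a of φ; convergence at r = 1 is due to a > 0.
  have hright : ∫⁻ r in Ioo ρ 1, ENNReal.ofReal (integralMean q f r ^ p * (φ r ^ p / (1 - r))) ≤
      ENNReal.ofReal (K ^ p) * ENNReal.ofReal (1 / (a * p)) := by
    have hm : 0 < a * p := mul_pos ha hp
    calc _ ≤ ∫⁻ r in Ioo ρ 1, ENNReal.ofReal (K ^ p) * (ENNReal.ofReal ((1 - ρ) ^ (-(a * p))) *
            ENNReal.ofReal ((1 - r) ^ (a * p - 1))) := by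
          refine setLIntegral_mono' measurableSet_Ioo fun r hr => ?_
          have hr' : r ∈ Ioo (0 : ℝ) 1 := ⟨h0.trans_lt hr.1, hr.2⟩
          have h1r : 0 < 1 - r := by linarith [hr'.2]
          have hφr := hφ.pos r (Ioo_subset_Ico_self hr')
          refine (hstep r hr' ((1 - ρ) ^ (-a) * (1 - r) ^ a) ?_).trans_eq ?_
          · have h1 := hφ.le_mul_rpow ρ r h0 hr.1.le hr.2
            rw [Real.div_rpow h1r.le hx.le] at h1
            have h2 : (1 - ρ * r) ^ (-t) ≤ (1 - ρ) ^ (-t) :=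
              Real.rpow_le_rpow_of_nonpos hx (hprod r hr').2 (by linarith)
            calc (1 - ρ) ^ t / φ ρ * (1 - ρ * r) ^ (-t) * φ r
                ≤ (1 - ρ) ^ t / φ ρ * (1 - ρ) ^ (-t) *
                  (φ ρ * ((1 - r) ^ a / (1 - ρ) ^ a)) := by gcongr
              _ = ((1 - ρ) ^ a)⁻¹ * (1 - r) ^ a := by
                  rw [Real.rpow_neg hx.le]
                  field_simp
              _ = _ := by rw [Real.rpow_neg hx.le]
          · rw [← ENNReal.ofReal_mul (p := (1 - ρ) ^ (-(a * p))) (by positivity)]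
            congr 2
            rw [Real.mul_rpow (by positivity) (by positivity), ← Real.rpow_mul hx.le,
              ← Real.rpow_mul h1r.le, Real.rpow_sub_one h1r.ne', neg_mul, mul_div_assoc]
      _ = ENNReal.ofReal (K ^ p) * (ENNReal.ofReal ((1 - ρ) ^ (-(a * p))) *
            ENNReal.ofReal ((1 - ρ) ^ (a * p) / (a * p))) := by
          rw [lintegral_const_mul' _ _ ENNReal.ofReal_ne_top,
            lintegral_const_mul' _ _ ENNReal.ofReal_ne_top,
            setLIntegral_one_sub_rpow_Ioo_one hm hρ]
      _ = _ := by
          rw [← ENNReal.ofReal_mul (p := (1 - ρ) ^ (-(a * p))) (by positivity),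
            ← mul_div_assoc, ← Real.rpow_add hx, neg_add_cancel, Real.rpow_zero]
  have hm1 : 0 < (t - b) * p := mul_pos (by linarith) hp
  have hm2 : 0 < a * p := mul_pos ha hp
  rw [mixedNormPow, ENNReal.ofReal_mul (by positivity), ENNReal.ofReal_add (by positivity)
    (by positivity), mul_add]
  refine le_trans (lintegral_mono_set (t := Ioc 0 ρ ∪ Ioo ρ 1) fun r hr => ?_)
    ((lintegral_union_le _ _ _).trans (add_le_add hleft hright))
  rcases le_or_gt r ρ with h | h
  · exact Or.inl ⟨hr.1, h⟩
  · exact Or.inr ⟨h, hr.2⟩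

theorem integralMean_le_of_norm_le {q : ℝ} (hq : 0 < q) {f : ℂ → ℂ} (hf : f ∈ discAnalytic)
    {B : ℝ} (hB : ∀ z, ‖z‖ < 1 → ‖f z‖ ≤ B) {r : ℝ} (hr : r ∈ Ioo (0 : ℝ) 1) :
    integralMean q f r ≤ B := by
  have hB0 : 0 ≤ B := (norm_nonneg _).trans (hB 0 (by simp))
  have hsph : ∀ z ∈ Metric.sphere (0 : ℂ) r, ‖z‖ < 1 := fun z hz => by
    rw [mem_sphere_zero_iff_norm] at hz
    exact hz ▸ hr.2
  have h1 : Real.circleAverage (fun z => ‖f z‖ ^ q) 0 r ≤ B ^ q := by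
    refine Real.circleAverage_mono_on_of_le_circle
      (circleIntegrable_norm_rpow hq hr.1.le (hf.1.continuousOn.mono
        (Metric.closedBall_subset_ball hr.2))) fun z hz => ?_
    rw [abs_of_pos hr.1] at hz
    exact Real.rpow_le_rpow (norm_nonneg _) (hB z (hsph z hz)) hq.le
  rw [integralMean_eq_circleAverage]
  refine (Real.rpow_le_rpow (Real.circleAverage_nonneg_of_nonneg fun z _ => by positivity) h1
    (by positivity)).trans_eq ?_
  rw [← Real.rpow_mul hB0, mul_one_div_cancel hq.ne', Real.rpow_one]

/-- Bounded analytic functions belong to `H(p, q, φ)`. -/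
theorem mem_mixedNormSpace_of_norm_le {p q : ℝ} (hp : 0 < p) (hq : 0 < q) {φ : ℝ → ℝ}
    (hφ : IsNormalFunction φ) {f : ℂ → ℂ} (hf : f ∈ discAnalytic)
    {B : ℝ} (hB : ∀ z, ‖z‖ < 1 → ‖f z‖ ≤ B) : f ∈ mixedNormSpace p q φ hp hq hφ := by
  obtain ⟨a, b, h⟩ := hφ.exists_normalBounds
  have hB0 : 0 ≤ B := (norm_nonneg _).trans (hB 0 (by simp))
  have hφ0 := h.pos 0 ⟨le_rfl, one_pos⟩
  -- With ρ = 0 the comparison function is the constant 1/φ(0), hence this K.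
  refine ⟨hf, (h.mixedNormPow_le_of_integralMean_le hp (K := B * φ 0) (t := b + 1) (ρ := 0)
    (by positivity) (by linarith) le_rfl one_pos fun r hr => ?_).trans_lt ENNReal.ofReal_lt_top⟩
  refine (integralMean_le_of_norm_le hq hf hB hr).trans_eq ?_
  simp only [sub_zero, zero_mul, Real.one_rpow, mul_one]
  field_simp

/-! ### Circular means and derivatives of the kernels -/

/-- For s ≤ 1/2 the distance is at least 1 - s ≥ 1/2, and |θ| ≤ π is absorbed by the factor 8. For s
> 1/2 the squared distance is (1-s)² + 2s(1 - cos θ), and 1 - cos θ ≥ 2θ²/π² ≥ θ²/5. -/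
theorem one_sub_add_abs_div_le_norm {s θ : ℝ} (hs : 0 ≤ s) (hs1 : s < 1) (hθ : |θ| ≤ Real.pi) :
    (1 - s + |θ|) / 8 ≤ ‖1 - (s : ℂ) * Complex.exp (θ * Complex.I)‖ := by
  have habs := abs_nonneg θ
  rcases le_or_gt s (1 / 2) with h | h
  · have h1 : 1 - s ≤ ‖1 - (s : ℂ) * Complex.exp (θ * Complex.I)‖ := by
      have := norm_sub_norm_le (1 : ℂ) ((s : ℂ) * Complex.exp (θ * Complex.I))
      rwa [norm_one, norm_mul, Complex.norm_exp_ofReal_mul_I, mul_one, Complex.norm_real,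
        Real.norm_of_nonneg hs] at this
    linarith [Real.pi_lt_d2]
  · have hsq : ‖1 - (s : ℂ) * Complex.exp (θ * Complex.I)‖ ^ 2 =
        (1 - s) ^ 2 + 2 * s * (1 - Real.cos θ) := by
      rw [← Complex.normSq_eq_norm_sq, Complex.normSq_apply, Complex.exp_mul_I]
      simp only [Complex.sub_re, Complex.one_re, Complex.mul_re, Complex.ofReal_re, Complex.add_re,
        Complex.cos_ofReal_re, Complex.sin_ofReal_re, Complex.I_re, Complex.sin_ofReal_im,
        Complex.I_im, Complex.ofReal_im, Complex.add_im, Complex.cos_ofReal_im, Complex.mul_im,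
        Complex.sub_im, Complex.one_im]
      linear_combination s ^ 2 * Real.sin_sq_add_cos_sq θ
    have hcos := Real.cos_le_one_sub_mul_cos_sq hθ
    have hpi : (1 : ℝ) / 5 * θ ^ 2 ≤ 2 / Real.pi ^ 2 * θ ^ 2 := by
      refine mul_le_mul_of_nonneg_right ?_ (sq_nonneg _)
      rw [div_le_div_iff₀ (by norm_num) (by positivity)]
      nlinarith [Real.pi_lt_d2, Real.pi_pos]
    refine le_of_sq_le_sq ?_ (norm_nonneg _)
    rw [hsq]
    have h3 : (1 : ℝ) / 5 * θ ^ 2 ≤ 1 - Real.cos θ := by linarith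
    have h4 : 1 - Real.cos θ ≤ 2 * s * (1 - Real.cos θ) := by
      nlinarith [sq_nonneg θ]
    nlinarith [sq_abs θ, sq_nonneg (1 - s - |θ|)]

/-- The integrand is at most 8^m (1-s+|θ|)^(-m), and integrating in θ raises the exponent by one
because m > 1. With m = Nq this computes the mean M_q of the kernels. -/
theorem circleAverage_norm_one_sub_rpow_le {m s : ℝ} (hm : 1 < m) (hs : 0 ≤ s) (hs1 : s < 1) :
    Real.circleAverage (fun z => ‖1 - z‖ ^ (-m)) 0 s ≤ 8 ^ m / (m - 1) * (1 - s) ^ (1 - m) := by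
  have hpi := Real.pi_pos
  have hx : 0 < 1 - s := by linarith
  have hm1 : 0 < m - 1 := by linarith
  have hne : ∀ θ : ℝ, 0 < ‖1 - circleMap 0 s θ‖ := fun θ => by
    rw [norm_pos_iff, sub_ne_zero]
    intro h
    have := congrArg norm h
    rw [norm_one, norm_circleMap_zero, abs_of_nonneg hs] at this
    linarith
  have hcont : Continuous fun θ => ‖1 - circleMap 0 s θ‖ ^ (-m) :=
    ((continuous_const.sub (continuous_circleMap 0 s)).norm).rpow_const fun θ => Or.inl (hne θ).ne'
  have hper : Function.Periodic (fun θ => ‖1 - circleMap 0 s θ‖ ^ (-m)) (2 * Real.pi) := fun θ => by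
    simp [periodic_circleMap 0 s θ]
  have hbd : ∀ θ : ℝ, |θ| ≤ Real.pi →
      ‖1 - circleMap 0 s θ‖ ^ (-m) ≤ 8 ^ m * (1 - s + |θ|) ^ (-m) := fun θ hθ => by
    have h1 := one_sub_add_abs_div_le_norm hs hs1 hθ
    rw [← circleMap_zero] at h1
    have h2 := abs_nonneg θ
    refine (Real.rpow_le_rpow_of_nonpos (by positivity) h1 (by linarith)).trans_eq ?_
    rw [Real.div_rpow (by positivity) (by norm_num), Real.rpow_neg (x := 8) (by norm_num), div_inv_eq_mul,
      mul_comm]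
  have hint : ∫ u in (1 - s)..(1 - s + Real.pi), u ^ (-m) ≤ (1 - s) ^ (1 - m) / (m - 1) := by
    have := integral_rpow_neg_le hm1 hx (by linarith : 1 - s ≤ 1 - s + Real.pi)
    rwa [show -(m - 1) - 1 = -m by ring, show -(m - 1) = 1 - m by ring] at this
  have hc1 : ContinuousOn (fun θ : ℝ => 8 ^ m * (1 - s + θ) ^ (-m)) (Icc 0 Real.pi) :=
    continuousOn_const.mul (ContinuousOn.rpow_const (by fun_prop) fun θ hθ => Or.inl (by
      linarith [hθ.1]))
  have hc2 : ContinuousOn (fun θ : ℝ => 8 ^ m * (1 - s - θ) ^ (-m)) (Icc (-Real.pi) 0) :=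
    continuousOn_const.mul (ContinuousOn.rpow_const (by fun_prop) fun θ hθ => Or.inl (by
      linarith [hθ.2]))
  have hI1 : ∫ θ in (0 : ℝ)..Real.pi, ‖1 - circleMap 0 s θ‖ ^ (-m) ≤
      8 ^ m * ((1 - s) ^ (1 - m) / (m - 1)) := by
    calc _ ≤ ∫ θ in (0 : ℝ)..Real.pi, 8 ^ m * (1 - s + θ) ^ (-m) := by
          refine intervalIntegral.integral_mono_on hpi.le (hcont.intervalIntegrable _ _)
            (hc1.intervalIntegrable_of_Icc hpi.le) fun θ hθ => ?_
          have := hbd θ (by rw [abs_of_nonneg hθ.1]; exact hθ.2)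
          rwa [abs_of_nonneg hθ.1] at this
      _ = 8 ^ m * ∫ u in (1 - s)..(1 - s + Real.pi), u ^ (-m) := by
          rw [intervalIntegral.integral_const_mul,
            intervalIntegral.integral_comp_add_left (fun u : ℝ => u ^ (-m)), add_zero]
      _ ≤ _ := by gcongr
  have hI2 : ∫ θ in (-Real.pi)..0, ‖1 - circleMap 0 s θ‖ ^ (-m) ≤
      8 ^ m * ((1 - s) ^ (1 - m) / (m - 1)) := by
    calc _ ≤ ∫ θ in (-Real.pi)..0, 8 ^ m * (1 - s - θ) ^ (-m) := by
          refine intervalIntegral.integral_mono_on (by linarith) (hcont.intervalIntegrable _ _)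
            (hc2.intervalIntegrable_of_Icc (by linarith)) fun θ hθ => ?_
          have := hbd θ (by rw [abs_of_nonpos hθ.2]; linarith [hθ.1])
          rwa [abs_of_nonpos hθ.2, ← sub_eq_add_neg] at this
      _ = 8 ^ m * ∫ u in (1 - s)..(1 - s + Real.pi), u ^ (-m) := by
          rw [intervalIntegral.integral_const_mul,
            intervalIntegral.integral_comp_sub_left (fun u : ℝ => u ^ (-m)), sub_zero, sub_neg_eq_add]
      _ ≤ _ := by gcongr
  have hshift := hper.intervalIntegral_add_eq (-Real.pi) 0
  rw [show -Real.pi + 2 * Real.pi = Real.pi by ring, zero_add] at hshift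
  rw [Real.circleAverage_def, smul_eq_mul, ← hshift,
    ← intervalIntegral.integral_add_adjacent_intervals (hcont.intervalIntegrable (-Real.pi) 0)
      (hcont.intervalIntegrable 0 Real.pi)]
  set X := 8 ^ m * ((1 - s) ^ (1 - m) / (m - 1)) with hX
  have hX0 : 0 ≤ X := by positivity
  calc _ ≤ (2 * Real.pi)⁻¹ * (X + X) := by gcongr
    _ = Real.pi⁻¹ * X := by field_simp; ring
    _ ≤ 1 * X := by
        gcongr
        exact inv_le_one_of_one_le₀ (by linarith [Real.pi_gt_three])
    _ = _ := by rw [hX]; ring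

theorem iteratedDeriv_inv_one_sub_mul_pow (c : ℂ) (N n : ℕ) :
    ∀ z : ℂ, 1 - c * z ≠ 0 → iteratedDeriv n (fun z => ((1 - c * z) ^ N)⁻¹) z =
      c ^ n * N.ascFactorial n * ((1 - c * z) ^ (N + n))⁻¹ := by
  induction n with
  | zero => intro z _; simp
  | succ n ih =>
    intro z hz
    rw [iteratedDeriv_succ]
    have hev : iteratedDeriv n (fun z => ((1 - c * z) ^ N)⁻¹) =ᶠ[𝓝 z]
        fun z => c ^ n * N.ascFactorial n * ((1 - c * z) ^ (N + n))⁻¹ := by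
      have : ∀ᶠ y in 𝓝 z, 1 - c * y ≠ 0 :=
        (by fun_prop : Continuous fun y => 1 - c * y).continuousAt.eventually_ne hz
      filter_upwards [this] with y hy using ih y hy
    rw [hev.deriv_eq]
    have h1 : HasDerivAt (fun y : ℂ => 1 - c * y) (-c) z := by
      simpa using ((hasDerivAt_id z).const_mul c).const_sub 1
    have h2 := ((h1.pow (N + n)).inv (pow_ne_zero _ hz)).const_mul (c ^ n * (N.ascFactorial n : ℂ))
    refine h2.deriv.trans ?_
    rw [Nat.ascFactorial_succ]
    -- The exponent `N + n - 1` from differentiating a power is a truncated subtraction, so `N + n =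
    -- 0` is treated apart.
    rcases Nat.eq_zero_or_pos (N + n) with h0 | h0
    · obtain ⟨rfl, rfl⟩ : N = 0 ∧ n = 0 := by omega
      simp
    · obtain ⟨k, hk⟩ : ∃ k, N + n = k + 1 := ⟨N + n - 1, by omega⟩
      rw [show N + (n + 1) = k + 2 by omega, hk]
      simp only [Pi.pow_apply, Nat.add_sub_cancel]
      push_cast
      field_simp
      ring

/-! ### The derivative of the integration operator -/

theorem differentiableOn_iteratedDeriv {f : ℂ → ℂ} (hf : f ∈ discAnalytic) (n : ℕ) :
    DifferentiableOn ℂ (iteratedDeriv n f) (Metric.ball 0 1) := by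
  rw [iteratedDeriv_eq_iterate]
  exact ((discAnalytic_analyticOnNhd hf).iterated_deriv n).differentiableOn

/-- On the disc h has a primitive H, and the fundamental theorem of calculus along the segment
identifies the integral with H(z) - H(0). -/
theorem hasDerivAt_mul_integral_segment {h : ℂ → ℂ} (hh : DifferentiableOn ℂ h (Metric.ball 0 1))
    {z : ℂ} (hz : z ∈ Metric.ball (0 : ℂ) 1) :
    HasDerivAt (fun z => z * ∫ t in (0 : ℝ)..1, h (t * z)) (h z) z := by
  obtain ⟨H, hH⟩ := hh.isExactOn_ball
  have hmem : ∀ y ∈ Metric.ball (0 : ℂ) 1, ∀ t ∈ Icc (0 : ℝ) 1, (t * y : ℂ) ∈ Metric.ball (0 : ℂ) 1 := by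
    intro y hy t ht
    rw [mem_ball_zero_iff] at hy ⊢
    rw [norm_mul, Complex.norm_real, Real.norm_of_nonneg ht.1]
    exact (mul_le_of_le_one_left (norm_nonneg _) ht.2).trans_lt hy
  have heq : ∀ y ∈ Metric.ball (0 : ℂ) 1, y * ∫ t in (0 : ℝ)..1, h (t * y) = H y - H 0 := by
    intro y hy
    have hd : ∀ t ∈ uIcc (0 : ℝ) 1,
        HasDerivAt (fun t : ℝ => H (t * y)) (y * h (t * y)) t := by
      intro t ht
      rw [uIcc_of_le zero_le_one] at ht
      have h1 : HasDerivAt (fun t : ℝ => (t * y : ℂ)) y t := by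
        simpa using (Complex.ofRealCLM.hasDerivAt (x := t)).mul_const y
      have := (hH _ (hmem y hy t ht)).comp t h1
      rwa [mul_comm] at this
    have hc : ContinuousOn (fun t : ℝ => y * h (t * y)) (uIcc 0 1) := by
      rw [uIcc_of_le zero_le_one]
      exact continuousOn_const.mul (hh.continuousOn.comp (by fun_prop) fun t ht => hmem y hy t ht)
    have := intervalIntegral.integral_eq_sub_of_hasDerivAt hd hc.intervalIntegrable
    rw [intervalIntegral.integral_const_mul] at this
    simpa using this
  refine ((hH z hz).sub_const (H 0)).congr_of_eventuallyEq ?_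
  filter_upwards [Metric.isOpen_ball.mem_nhds hz] with y hy using heq y hy

/-- This removes the integral from the problem: the Bloch norm sees only the product f⁽ⁿ⁾(ψ(z))
g(z). -/
theorem hasDerivAt_genIntegrationOp (n : ℕ) {ψ g f : ℂ → ℂ} (hψ : IsAnalyticSelfMap ψ)
    (hg : DifferentiableOn ℂ g (Metric.ball 0 1)) (hf : f ∈ discAnalytic) {z : ℂ}
    (hz : z ∈ Metric.ball (0 : ℂ) 1) :
    HasDerivAt (genIntegrationOp n ψ g f) (iteratedDeriv n f (ψ z) * g z) z := by
  have hh : DifferentiableOn ℂ (fun ξ => iteratedDeriv n f (ψ ξ) * g ξ) (Metric.ball 0 1) :=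
    ((differentiableOn_iteratedDeriv hf n).comp hψ.1 hψ.2).mul hg
  refine (hasDerivAt_mul_integral_segment hh hz).congr_of_eventuallyEq ?_
  filter_upwards [Metric.isOpen_ball.mem_nhds hz] with y hy
  rw [genIntegrationOp, if_pos hy]

theorem genIntegrationOp_apply_zero (n : ℕ) (ψ g f : ℂ → ℂ) : genIntegrationOp n ψ g f 0 = 0 := by
  simp [genIntegrationOp]

/-! ### Normalised kernels -/

/-- Standard kernel functions, normalised in `H(p, q, φ)`: their norms are bounded, their `n`-th
derivatives have the largest possible size at the given point, and they tend to zero locally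
uniformly as the point tends to the boundary. -/
theorem NormalBounds.exists_kernels {p q : ℝ} (hp : 0 < p) (hq : 0 < q) {φ : ℝ → ℝ} {a b : ℝ}
    (hφ : NormalBounds φ a b) (n : ℕ) :
    ∃ (c K : ℝ) (F : ℂ → ℂ → ℂ), 0 < c ∧ 0 < K ∧
      (∀ w : ℂ, ‖w‖ < 1 → F w ∈ discAnalytic ∧ mixedNormPow p q φ (F w) ≤ ENNReal.ofReal K) ∧
      (∀ w : ℂ, 1 / 2 ≤ ‖w‖ → ‖w‖ < 1 →
        c ≤ ‖iteratedDeriv n (F w) w‖ * growthWeight q φ n ‖w‖) ∧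
      ∀ z : ℂ, ‖z‖ < 1 → ∀ w : ℕ → ℂ, (∀ k, ‖w k‖ < 1) → Tendsto (fun k => ‖w k‖) atTop (𝓝 1) →
        Tendsto (fun k => iteratedDeriv n (F (w k)) z) atTop (𝓝 0) := by
  have hb : 0 < b := hφ.exponent_pos.trans hφ.exponent_lt
  have hφ0 := hφ.pos 0 ⟨le_rfl, one_pos⟩
  -- This size of N serves twice: t = N - 1/q exceeds b, as the norm criterion and the decay of the
  -- kernels demand, and Nq > 1, as the circular mean demands.
  obtain ⟨N, hN⟩ := exists_nat_gt (b + 1 / q)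
  have hq1 : 0 < 1 / q := by positivity
  set t : ℝ := N - 1 / q with ht
  have htb : b < t := by linarith
  have hN0 : 0 < (N : ℝ) := by linarith
  have hm : 1 < N * q := by
    have : 1 / q < N := by linarith
    rwa [div_lt_iff₀ hq] at this
  have hm1 : 0 < N * q - 1 := by linarith
  set A : ℂ → ℝ := fun w => (1 - ‖w‖) ^ t / φ ‖w‖ with hA
  have hA0 : ∀ w : ℂ, ‖w‖ < 1 → 0 ≤ A w := fun w hw =>
    div_nonneg (Real.rpow_nonneg (by linarith) _) (hφ.pos _ ⟨norm_nonneg _, hw⟩).le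
  set h : ℂ → ℂ → ℂ := fun w z => (A w : ℂ) * ((1 - (starRingEnd ℂ) w * z) ^ N)⁻¹ with hh
  have hle : ∀ w z : ℂ, ‖w‖ < 1 → ‖z‖ < 1 → 1 - ‖z‖ ≤ ‖1 - (starRingEnd ℂ) w * z‖ := by
    intro w z hw hz
    have h1 := norm_sub_norm_le (1 : ℂ) ((starRingEnd ℂ) w * z)
    rw [norm_one, norm_mul, Complex.norm_conj] at h1
    have := mul_le_mul_of_nonneg_right hw.le (norm_nonneg z)
    linarith
  have hne : ∀ w z : ℂ, ‖w‖ < 1 → ‖z‖ < 1 → 1 - (starRingEnd ℂ) w * z ≠ 0 := fun w z hw hz =>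
    norm_pos_iff.1 ((by linarith : 0 < 1 - ‖z‖).trans_le (hle w z hw hz))
  have hder : ∀ w z : ℂ, ‖w‖ < 1 → ‖z‖ < 1 →
      iteratedDeriv n ((Metric.ball (0 : ℂ) 1).indicator (h w)) z =
        A w * ((starRingEnd ℂ) w ^ n * N.ascFactorial n *
          ((1 - (starRingEnd ℂ) w * z) ^ (N + n))⁻¹) := by
    intro w z hw hz
    rw [iteratedDeriv_indicator_ball _ _ hz, hh, iteratedDeriv_const_mul_field,
      iteratedDeriv_inv_one_sub_mul_pow _ _ _ _ (hne w z hw hz)]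
  set C : ℝ := (8 ^ (N * q) / (N * q - 1)) ^ (1 / q) with hC
  have hC0 : 0 < C := by positivity
  have hab := hφ.exponent_pos
  have htb' : 0 < t - b := by linarith
  refine ⟨(2 ^ (N + n))⁻¹ * (1 / 2) ^ n, C ^ p * (1 / ((t - b) * p) + 1 / (a * p)),
    fun w => (Metric.ball (0 : ℂ) 1).indicator (h w), by positivity, by positivity, ?_, ?_, ?_⟩
  · intro w hw
    refine ⟨indicator_ball_mem_discAnalytic fun z hz => ?_, ?_⟩
    · have := hne w z hw (mem_ball_zero_iff.1 hz)
      refine DifferentiableAt.differentiableWithinAt ?_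
      refine DifferentiableAt.const_mul (DifferentiableAt.inv (by fun_prop) ?_) _
      exact pow_ne_zero _ this
    · refine hφ.mixedNormPow_le_of_integralMean_le hp hC0.le htb (norm_nonneg w) hw fun r hr => ?_
      rw [integralMean_indicator_ball q _ hr]
      -- On |z| = r the kernel depends on ζe^(iθ) alone, so its mean is that of |1-z|^(-Nq) on the
      -- circle of radius |w|r. The power 1/q turns the exponent 1 - Nq into -t.
      set ζ : ℂ := (starRingEnd ℂ) w * r with hζ
      have hζn : ‖ζ‖ = ‖w‖ * r := by
        rw [hζ, norm_mul, Complex.norm_conj, Complex.norm_real, Real.norm_of_nonneg hr.1.le]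
      have hζ1 : ‖ζ‖ < 1 := by
        rw [hζn]
        nlinarith [hr.1, hr.2, norm_nonneg w]
      have hu := circleAverage_norm_one_sub_rpow_le hm (norm_nonneg ζ) hζ1
      rw [circleAverage_zero_eq_integral_mul_exp] at hu
      have hpt : ∀ θ : ℝ, ‖h w (r * Complex.exp (θ * Complex.I))‖ ^ q =
          A w ^ q * ‖1 - ζ * Complex.exp (θ * Complex.I)‖ ^ (-(N * q)) := fun θ => by
        rw [hh]
        simp only
        rw [norm_mul, Complex.norm_real, Real.norm_of_nonneg (hA0 w hw),
          Real.mul_rpow (hA0 w hw) (norm_nonneg _), norm_inv, norm_pow, ← mul_assoc, ← hζ,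
          ← Real.rpow_natCast, ← Real.rpow_neg (norm_nonneg _), ← Real.rpow_mul (norm_nonneg _),
          neg_mul]
      rw [integralMean]
      simp_rw [hpt]
      rw [intervalIntegral.integral_const_mul, mul_left_comm]
      have hx : 0 < 1 - ‖ζ‖ := by linarith
      have hI : 0 ≤ (2 * Real.pi)⁻¹ * ∫ θ in (0 : ℝ)..(2 * Real.pi),
          ‖1 - ζ * Complex.exp (θ * Complex.I)‖ ^ (-(N * q)) :=
        mul_nonneg (by positivity)
          (intervalIntegral.integral_nonneg (by positivity) fun _ _ => by positivity)
      have hAw := hA0 w hw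
      rw [Real.mul_rpow (by positivity) hI, ← Real.rpow_mul hAw, mul_one_div_cancel hq.ne',
        Real.rpow_one]
      refine (mul_le_mul_of_nonneg_left (Real.rpow_le_rpow hI hu hq1.le) hAw).trans_eq ?_
      rw [Real.mul_rpow (by positivity) (by positivity), ← Real.rpow_mul hx.le, ← hC, hζn,
        show (1 - N * q) * (1 / q) = -t by rw [ht]; field_simp; ring]
      ring
  · intro w hw2 hw
    have hx : 0 < 1 - ‖w‖ := by linarith
    have hφw := hφ.pos _ ⟨norm_nonneg w, hw⟩
    rw [hder w w hw hw]
    have hcw : 1 - (starRingEnd ℂ) w * w = ((1 - ‖w‖ ^ 2 : ℝ) : ℂ) := by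
      rw [mul_comm, Complex.mul_conj, Complex.normSq_eq_norm_sq]
      push_cast
      rfl
    have hx2 : 0 < 1 - ‖w‖ ^ 2 := by nlinarith [norm_nonneg w]
    rw [hcw, norm_mul, norm_mul, norm_mul, norm_inv, norm_pow, norm_pow, Complex.norm_conj,
      Complex.norm_real, Complex.norm_real, Complex.norm_natCast, Real.norm_of_nonneg (hA0 w hw),
      Real.norm_of_nonneg hx2.le]
    have hasc : (1 : ℝ) ≤ N.ascFactorial n := by
      have hNn : 0 < N := by exact_mod_cast hN0
      exact_mod_cast Nat.succ_le_of_lt (by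
        have := Nat.ascFactorial_pos (N - 1) n
        rwa [Nat.sub_add_cancel hNn] at this)
    -- From 1 - |w|² ≤ 2(1 - |w|).
    have hinv : (2 ^ (N + n))⁻¹ * ((1 - ‖w‖) ^ (N + n))⁻¹ ≤ ((1 - ‖w‖ ^ 2) ^ (N + n))⁻¹ := by
      rw [← mul_inv, ← mul_pow]
      gcongr
      nlinarith [norm_nonneg w]
    have hpow : A w * ((1 - ‖w‖) ^ (N + n))⁻¹ * growthWeight q φ n ‖w‖ = 1 := by
      rw [hA, growthWeight, ht]
      simp only
      rw [← Real.rpow_natCast, div_mul_eq_mul_div, div_mul_eq_mul_div, div_eq_one_iff_eq hφw.ne',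
        ← Real.rpow_neg hx.le, ← Real.rpow_add hx, mul_left_comm, ← Real.rpow_add hx]
      rw [show (N : ℝ) - 1 / q + -((N + n : ℕ) : ℝ) + (1 / q + n) = 0 by push_cast; ring]
      simp
    have hG := hφ.growthWeight_pos q n (norm_nonneg w) hw
    have hAw := hA0 w hw
    calc (2 ^ (N + n))⁻¹ * (1 / 2) ^ n
        = (2 ^ (N + n))⁻¹ * (1 / 2) ^ n *
          (A w * ((1 - ‖w‖) ^ (N + n))⁻¹ * growthWeight q φ n ‖w‖) := by rw [hpow, mul_one]
      _ = A w * ((1 / 2) ^ n * 1 * ((2 ^ (N + n))⁻¹ * ((1 - ‖w‖) ^ (N + n))⁻¹)) *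
          growthWeight q φ n ‖w‖ := by ring
      _ ≤ _ := by gcongr
  · intro z hz w hw hlim
    have hz0 : 0 < 1 - ‖z‖ := by linarith
    have hbound : ∀ k, ‖iteratedDeriv n ((Metric.ball (0 : ℂ) 1).indicator (h (w k))) z‖ ≤
        (1 - ‖w k‖) ^ (t - b) * ((φ 0)⁻¹ * (N.ascFactorial n * ((1 - ‖z‖) ^ (N + n))⁻¹)) := by
      intro k
      have hx : 0 < 1 - ‖w k‖ := by linarith [hw k]
      have hφw := hφ.pos _ ⟨norm_nonneg (w k), hw k⟩
      rw [hder _ z (hw k) hz, norm_mul, norm_mul, norm_mul, norm_inv, norm_pow, norm_pow,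
        Complex.norm_conj, Complex.norm_real, Complex.norm_natCast,
        Real.norm_of_nonneg (hA0 _ (hw k))]
      -- The lower bound φ(s) ≥ φ(0)(1-s)^b leaves a positive power of 1 - |w_k|; at a fixed z the
      -- other factors stay bounded.
      have h1 : A (w k) ≤ (1 - ‖w k‖) ^ (t - b) * (φ 0)⁻¹ := by
        have h2 := hφ.mul_rpow_le 0 ‖w k‖ le_rfl (norm_nonneg _) (hw k)
        rw [sub_zero, div_one] at h2
        rw [hA]
        simp only
        rw [div_le_iff₀ hφw]
        calc (1 - ‖w k‖) ^ t = (1 - ‖w k‖) ^ (t - b) * (φ 0)⁻¹ * (φ 0 * (1 - ‖w k‖) ^ b) := by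
              rw [mul_assoc, inv_mul_cancel_left₀ hφ0.ne', ← Real.rpow_add hx, sub_add_cancel]
          _ ≤ _ := by gcongr
      have h3 : ‖w k‖ ^ n ≤ 1 := pow_le_one₀ (norm_nonneg _) (hw k).le
      have h4 := hle (w k) z (hw k) hz
      calc _ ≤ (1 - ‖w k‖) ^ (t - b) * (φ 0)⁻¹ *
            (1 * N.ascFactorial n * ((1 - ‖z‖) ^ (N + n))⁻¹) := by gcongr
        _ = _ := by ring
    refine squeeze_zero_norm hbound ?_
    have h1 : Tendsto (fun k => (1 - ‖w k‖) ^ (t - b)) atTop (𝓝 0) := by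
      have := (hlim.const_sub 1).rpow_const (p := t - b) (Or.inr htb'.le)
      simpa [Real.zero_rpow htb'.ne'] using this
    simpa using h1.mul_const _

/-! ### The lower bound -/

theorem contDiffAt_of_mem_discAnalytic {f : ℂ → ℂ} (hf : f ∈ discAnalytic) (n : ℕ) {z : ℂ}
    (hz : ‖z‖ < 1) : ContDiffAt ℂ n f z :=
  (discAnalytic_analyticOnNhd hf z (mem_ball_zero_iff.2 hz)).contDiffAt

theorem integralMean_smul {q : ℝ} (hq : 0 < q) (c : ℂ) (f : ℂ → ℂ) (r : ℝ) :
    integralMean q (c • f) r = ‖c‖ * integralMean q f r := by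
  have nn : 0 ≤ (2 * Real.pi)⁻¹ *
      ∫ θ in (0 : ℝ)..(2 * Real.pi), ‖f (r * Complex.exp (θ * Complex.I))‖ ^ q :=
    mul_nonneg (by positivity)
      (intervalIntegral.integral_nonneg (by positivity) (fun _ _ => by positivity))
  simp only [integralMean, Pi.smul_apply, norm_smul,
    Real.mul_rpow (norm_nonneg c) (norm_nonneg _), intervalIntegral.integral_const_mul]
  rw [mul_left_comm, Real.mul_rpow (by positivity) nn, ← Real.rpow_mul (norm_nonneg c),
    mul_one_div_cancel hq.ne', Real.rpow_one]

theorem mixedNormPow_smul {p q : ℝ} (hq : 0 < q) (φ : ℝ → ℝ) (c : ℂ) (f : ℂ → ℂ) :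
    mixedNormPow p q φ (c • f) = ENNReal.ofReal (‖c‖ ^ p) * mixedNormPow p q φ f := by
  unfold mixedNormPow
  rw [← lintegral_const_mul' _ _ ENNReal.ofReal_ne_top]
  refine lintegral_congr (fun r => ?_)
  rw [integralMean_smul hq, Real.mul_rpow (norm_nonneg c) (integralMean_nonneg q f r),
    ← ENNReal.ofReal_mul (by positivity), mul_assoc]

theorem mixedNorm_smul {p q : ℝ} (hp : 0 < p) (hq : 0 < q) (φ : ℝ → ℝ) (c : ℂ) (f : ℂ → ℂ) :
    mixedNorm p q φ (c • f) = ENNReal.ofReal ‖c‖ * mixedNorm p q φ f := by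
  rw [mixedNorm, mixedNorm, mixedNormPow_smul hq, ENNReal.mul_rpow_of_nonneg _ _ (by positivity),
    ENNReal.ofReal_rpow_of_nonneg (by positivity) (by positivity), ← Real.rpow_mul (norm_nonneg c),
    mul_one_div_cancel hp.ne', Real.rpow_one]

/-- The quasi-triangle inequality in `H(p, q, φ)`. -/
theorem mixedNormPow_sub_le {p q : ℝ} (hp : 0 < p) (hq : 0 < q) {φ : ℝ → ℝ}
    (hφ : IsNormalFunction φ) {f g : ℂ → ℂ} (hf : f ∈ discAnalytic) (hg : g ∈ discAnalytic) :
    mixedNormPow p q φ (f - g) ≤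
      ENNReal.ofReal (((2 ^ q) ^ (1 / q) * 2 ^ (1 / q)) ^ p * 2 ^ p) *
        (mixedNormPow p q φ f + mixedNormPow p q φ g) := by
  have hm : AEMeasurable (fun r : ℝ =>
      ENNReal.ofReal (integralMean q f r ^ p * (φ r ^ p / (1 - r))))
      (volume.restrict (Ioo (0 : ℝ) 1)) := by
    refine AEMeasurable.ennreal_ofReal (AEMeasurable.mul
      ((integralMean_measurable q hf).pow_const p).aemeasurable (AEMeasurable.div ?_ ?_))
    · exact ((hφ.1.mono Ioo_subset_Ico_self).aemeasurable measurableSet_Ioo).pow_const p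
    · exact (measurable_const.sub measurable_id).aemeasurable
  unfold mixedNormPow
  rw [← lintegral_add_left' hm, ← lintegral_const_mul' _ _ ENNReal.ofReal_ne_top]
  refine setLIntegral_mono' measurableSet_Ioo (fun r hr => ?_)
  have hw : 0 ≤ φ r ^ p / (1 - r) :=
    div_nonneg (Real.rpow_nonneg (hφ.2.1 r (Ioo_subset_Ico_self hr)).le _) (by linarith [hr.2])
  have a1 := integralMean_nonneg q f r
  have a2 := integralMean_nonneg q g r
  rw [← ENNReal.ofReal_add (by positivity) (by positivity),
    ← ENNReal.ofReal_mul (by positivity), ← add_mul, ← mul_assoc]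
  refine ENNReal.ofReal_le_ofReal (mul_le_mul_of_nonneg_right ?_ hw)
  have hadd := integralMean_add_le hq hf (discAnalytic.neg_mem hg) hr
  rw [← sub_eq_add_neg, show -g = (-1 : ℂ) • g by simp, integralMean_smul hq, norm_neg, norm_one,
    one_mul] at hadd
  refine (Real.rpow_le_rpow (integralMean_nonneg _ _ _) hadd hp.le).trans ?_
  rw [← mul_assoc, Real.mul_rpow (by positivity) (by positivity), mul_assoc]
  exact mul_le_mul_of_nonneg_left (add_rpow_le_two_rpow_mul a1 a2 hp.le) (by positivity)

theorem ofReal_mul_enorm_deriv_le_blochNorm (μ : ℂ → ℝ) (f : ℂ → ℂ) {z : ℂ} (hz : ‖z‖ < 1) :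
    ENNReal.ofReal (μ (‖z‖ : ℂ)) * ‖deriv f z‖ₑ ≤ blochNorm μ f :=
  (le_iSup₂ (f := fun z (_ : z ∈ Metric.ball (0 : ℂ) 1) =>
    ENNReal.ofReal (μ (‖z‖ : ℂ)) * ‖deriv f z‖ₑ) z (mem_ball_zero_iff.2 hz)).trans le_add_self

theorem differentiableAt_of_mem_blochSpace {μ : ℂ → ℝ} (f : blochSpace μ) {z : ℂ} (hz : ‖z‖ < 1) :
    DifferentiableAt ℂ (f : ℂ → ℂ) z :=
  f.2.1.1.differentiableAt (Metric.isOpen_ball.mem_nhds (mem_ball_zero_iff.2 hz))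

/-- Testing `T - S` on the difference of two functions bounds the derivative of the image of the
first one under `T`. -/
theorem ofReal_mul_enorm_deriv_le_of_sub {p q : ℝ} (hp : 0 < p) (hq : 0 < q) {φ : ℝ → ℝ}
    (hφ : IsNormalFunction φ) {n : ℕ} {μ : ℂ → ℝ} {ψ g : ℂ → ℂ} (hψ : IsAnalyticSelfMap ψ)
    (hg : DifferentiableOn ℂ g (Metric.ball 0 1))
    (S : mixedNormSpace p q φ hp hq hφ →ₗ[ℂ] blochSpace μ) (h : blochSpace μ)
    (f₁ f₂ : mixedNormSpace p q φ hp hq hφ) {K : ℝ} (hK : 0 < K)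
    (hf : mixedNorm p q φ (f₁ - f₂ : ℂ → ℂ) ≤ ENNReal.ofReal K) {z : ℂ} (hz : ‖z‖ < 1) :
    ENNReal.ofReal (μ (‖z‖ : ℂ)) * ‖iteratedDeriv n (f₁ : ℂ → ℂ) (ψ z) * g z‖ₑ ≤
      ENNReal.ofReal K *
          (⨆ (f : mixedNormSpace p q φ hp hq hφ) (_ : mixedNorm p q φ f ≤ 1),
            blochNorm μ (genIntegrationOp n ψ g f - (S f : ℂ → ℂ))) +
        blochNorm μ (S f₁ - h : blochSpace μ) + blochNorm μ (S f₂ - h : blochSpace μ) +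
        ENNReal.ofReal (μ (‖z‖ : ℂ)) * ‖iteratedDeriv n (f₂ : ℂ → ℂ) (ψ z) * g z‖ₑ := by
  have hzb : z ∈ Metric.ball (0 : ℂ) 1 := mem_ball_zero_iff.2 hz
  have hψz : ‖ψ z‖ < 1 := mem_ball_zero_iff.1 (hψ.2 hzb)
  set A := ⨆ (f : mixedNormSpace p q φ hp hq hφ) (_ : mixedNorm p q φ f ≤ 1),
    blochNorm μ (genIntegrationOp n ψ g f - (S f : ℂ → ℂ))
  have hK' : (K : ℂ) ≠ 0 := by exact_mod_cast hK.ne'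
  -- The difference scaled into the unit ball, hence admissible in the supremum `A`.
  set k : mixedNormSpace p q φ hp hq hφ := ((K : ℂ)⁻¹) • (f₁ - f₂) with hk
  have hk1 : mixedNorm p q φ k ≤ 1 := by
    rw [hk, Submodule.coe_smul, Submodule.coe_sub, mixedNorm_smul hp hq, norm_inv,
      Complex.norm_real, Real.norm_of_nonneg hK.le]
    calc _ ≤ ENNReal.ofReal K⁻¹ * ENNReal.ofReal K := by gcongr
      _ = 1 := by rw [← ENNReal.ofReal_mul (by positivity), inv_mul_cancel₀ hK.ne',
          ENNReal.ofReal_one]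
  set Y := deriv (genIntegrationOp n ψ g k - (S k : ℂ → ℂ)) z with hY
  have hYA : ENNReal.ofReal (μ (‖z‖ : ℂ)) * ‖Y‖ₑ ≤ A :=
    (ofReal_mul_enorm_deriv_le_blochNorm μ _ hz).trans
      (le_iSup₂ (f := fun (f : mixedNormSpace p q φ hp hq hφ) (_ : mixedNorm p q φ f ≤ 1) =>
        blochNorm μ (genIntegrationOp n ψ g f - (S f : ℂ → ℂ))) k hk1)
  set D₁ := deriv ((S f₁ - h : blochSpace μ) : ℂ → ℂ) z with hD₁
  set D₂ := deriv ((S f₂ - h : blochSpace μ) : ℂ → ℂ) z with hD₂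
  have hS := fun x : blochSpace μ => differentiableAt_of_mem_blochSpace x hz
  -- h cancels in D₁ - D₂ = (S f₁ - S f₂)'(z). It is inserted so that each Dᵢ is small separately
  -- once S fᵢ is near h.
  have hYeq : K * Y = (iteratedDeriv n (f₁ : ℂ → ℂ) (ψ z) - iteratedDeriv n (f₂ : ℂ → ℂ) (ψ z)) * g z -
      (D₁ - D₂) := by
    have hT := hasDerivAt_genIntegrationOp n hψ hg k.2.1 hzb
    rw [hY, deriv_sub hT.differentiableAt (hS _), hT.deriv, hD₁, hD₂, hk, map_smul, map_sub,
      Submodule.coe_smul, Submodule.coe_sub, Submodule.coe_smul, Submodule.coe_sub,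
      Submodule.coe_sub, Submodule.coe_sub, deriv_const_smul _ ((hS _).sub (hS _)),
      deriv_sub (hS _) (hS _), deriv_sub (hS _) (hS _), deriv_sub (hS _) (hS _),
      iteratedDeriv_const_smul_field, iteratedDeriv_sub (contDiffAt_of_mem_discAnalytic f₁.2.1 n hψz)
        (contDiffAt_of_mem_discAnalytic f₂.2.1 n hψz), smul_eq_mul, smul_eq_mul]
    field_simp
    ring
  have hdecomp : iteratedDeriv n (f₁ : ℂ → ℂ) (ψ z) * g z =
      K * Y + D₁ - D₂ + iteratedDeriv n (f₂ : ℂ → ℂ) (ψ z) * g z := by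
    rw [hYeq]
    ring
  have hKn : ‖(K : ℂ)‖ₑ = ENNReal.ofReal K := by
    rw [← ofReal_norm, Complex.norm_real, Real.norm_of_nonneg hK.le]
  calc _ ≤ ENNReal.ofReal (μ (‖z‖ : ℂ)) * (ENNReal.ofReal K * ‖Y‖ₑ + ‖D₁‖ₑ + ‖D₂‖ₑ +
        ‖iteratedDeriv n (f₂ : ℂ → ℂ) (ψ z) * g z‖ₑ) := by
        rw [hdecomp]
        gcongr
        refine (enorm_add_le _ _).trans ?_
        gcongr
        refine (enorm_sub_le).trans ?_
        gcongr
        refine (enorm_add_le _ _).trans ?_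
        rw [enorm_mul, hKn]
    _ = ENNReal.ofReal K * (ENNReal.ofReal (μ (‖z‖ : ℂ)) * ‖Y‖ₑ) +
        ENNReal.ofReal (μ (‖z‖ : ℂ)) * ‖D₁‖ₑ + ENNReal.ofReal (μ (‖z‖ : ℂ)) * ‖D₂‖ₑ +
        ENNReal.ofReal (μ (‖z‖ : ℂ)) * ‖iteratedDeriv n (f₂ : ℂ → ℂ) (ψ z) * g z‖ₑ := by ring
    _ ≤ _ := by
        gcongr
        · exact ofReal_mul_enorm_deriv_le_blochNorm μ _ hz
        · exact ofReal_mul_enorm_deriv_le_blochNorm μ _ hz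

/-- A value below the limsup is exceeded frequently along the filter. The rate 1/(k+2) makes
|ψ(z_k)| → 1 and keeps |ψ(z_k)| > 1/2 from k = 0 on, as the kernel estimate from below requires. -/
theorem exists_seq_of_lt_symbolLimsup {q : ℝ} {φ : ℝ → ℝ} {n : ℕ} {μ : ℂ → ℝ} {ψ g : ℂ → ℂ}
    {M : ℝ≥0∞} (hM : M < symbolLimsup q φ n μ ψ g) :
    ∃ z : ℕ → ℂ, (∀ k, ‖z k‖ < 1) ∧ (∀ k : ℕ, 1 - 1 / ((k : ℝ) + 2) < ‖ψ (z k)‖) ∧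
      ∀ k, M < ENNReal.ofReal (μ (‖z k‖ : ℂ) * ‖g (z k)‖ /
        (φ ‖ψ (z k)‖ * (1 - ‖ψ (z k)‖ ^ 2) ^ (1 / q + (n : ℝ)))) := by
  have hfr := frequently_lt_of_lt_limsup (by isBoundedDefault) hM
  have hex : ∀ k : ℕ, ∃ z : ℂ, ‖z‖ < 1 ∧ 1 - 1 / ((k : ℝ) + 2) < ‖ψ z‖ ∧
      M < ENNReal.ofReal (μ (‖z‖ : ℂ) * ‖g z‖ /
        (φ ‖ψ z‖ * (1 - ‖ψ z‖ ^ 2) ^ (1 / q + (n : ℝ)))) := by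
    intro k
    have hlt : 1 - 1 / ((k : ℝ) + 2) < 1 := sub_lt_self _ (by positivity)
    have hev : ∀ᶠ z : ℂ in comap (fun z => ‖ψ z‖) (𝓝[<] 1) ⊓ 𝓟 (Metric.ball 0 1),
        1 - 1 / ((k : ℝ) + 2) < ‖ψ z‖ ∧ ‖z‖ < 1 := by
      refine Filter.Eventually.and ?_ ?_
      · exact (Filter.Eventually.comap (eventually_nhdsWithin_of_eventually_nhds
          (lt_mem_nhds hlt)) _).filter_mono inf_le_left
      · refine Filter.Eventually.filter_mono inf_le_right ?_
        rw [eventually_principal]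
        exact fun z hz => mem_ball_zero_iff.1 hz
    obtain ⟨z, h1, h2, h3⟩ := (hfr.and_eventually hev).exists
    exact ⟨z, h3, h2, h1⟩
  choose z h1 h2 h3 using hex
  exact ⟨z, h1, h2, h3⟩

theorem growthWeight_le {q : ℝ} (hq : 0 < q) {φ : ℝ → ℝ} (n : ℕ) {s : ℝ} (h0 : 0 ≤ s) (h1 : s < 1)
    (hφs : 0 < φ s) :
    growthWeight q φ n s ≤ φ s * (1 - s ^ 2) ^ (1 / q + (n : ℝ)) :=
  mul_le_mul_of_nonneg_left
    (Real.rpow_le_rpow (by linarith) (by nlinarith) (by positivity)) hφs.le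

theorem le_two_rpow_mul_growthWeight {q : ℝ} (hq : 0 < q) {φ : ℝ → ℝ} (n : ℕ) {s : ℝ} (h0 : 0 ≤ s)
    (h1 : s < 1) (hφs : 0 < φ s) :
    φ s * (1 - s ^ 2) ^ (1 / q + (n : ℝ)) ≤
      2 ^ (1 / q + (n : ℝ)) * growthWeight q φ n s := by
  rw [growthWeight, mul_left_comm, ← Real.mul_rpow (by norm_num) (by linarith)]
  exact mul_le_mul_of_nonneg_left
    (Real.rpow_le_rpow (by nlinarith) (by nlinarith) (by positivity)) hφs.le

/-- T - S is tested on differences f_i - f_j of kernels at the points ψ(z_k), along a subsequence on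
which S f_k converges. Letting j → ∞ and then i → ∞ removes everything except ‖T - S‖. -/
theorem exists_mul_symbolLimsup_le_essentialNorm {p q : ℝ} (hp : 0 < p) (hq : 0 < q) {φ : ℝ → ℝ}
    (hφ : IsNormalFunction φ) (n : ℕ) :
    ∃ c : ℝ, 0 < c ∧ ∀ (μ : ℂ → ℝ) (ψ g : ℂ → ℂ), IsWeight μ → IsAnalyticSelfMap ψ →
      DifferentiableOn ℂ g (Metric.ball 0 1) →
      ENNReal.ofReal c * symbolLimsup q φ n μ ψ g ≤
        essentialNorm p q φ hp hq hφ μ (genIntegrationOp n ψ g) := by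
  obtain ⟨a, b, hb⟩ := hφ.exists_normalBounds
  obtain ⟨c, K, F, hc, hK, hF, hFlow, hFlim⟩ := hb.exists_kernels hp hq n
  set Q : ℝ := ((2 ^ q) ^ (1 / q) * 2 ^ (1 / q)) ^ p * 2 ^ p with hQ
  -- A bound for the quasi-norm of the difference of two kernels; Q is the constant of the
  -- quasi-triangle inequality for p-th powers.
  set K₂ : ℝ := (Q * (K + K)) ^ (1 / p) with hK₂
  have hK₂0 : 0 < K₂ := by positivity
  refine ⟨c / K₂, by positivity, fun μ ψ g hμ hψ hg => ?_⟩
  refine le_iInf₂ fun S hS => ?_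
  set A := ⨆ (f : mixedNormSpace p q φ hp hq hφ) (_ : mixedNorm p q φ f ≤ 1),
    blochNorm μ (genIntegrationOp n ψ g f - (S f : ℂ → ℂ)) with hA
  suffices hmain : ∀ M < symbolLimsup q φ n μ ψ g, M ≤ ENNReal.ofReal (K₂ / c) * A by
    calc _ ≤ ENNReal.ofReal (c / K₂) * (ENNReal.ofReal (K₂ / c) * A) := by
          gcongr
          exact le_of_forall_lt_imp_le_of_dense hmain
      _ = A := by
          rw [← mul_assoc, ← ENNReal.ofReal_mul (by positivity)]
          simp [div_mul_div_cancel₀', hc.ne', hK₂0.ne']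
  intro M hM
  obtain ⟨z, hz, hψz, hval⟩ := exists_seq_of_lt_symbolLimsup hM
  have hw1 : ∀ k, ‖ψ (z k)‖ < 1 := fun k => mem_ball_zero_iff.1 (hψ.2 (mem_ball_zero_iff.2 (hz k)))
  have hw2 : ∀ k, 1 / 2 ≤ ‖ψ (z k)‖ := fun k => by
    refine le_trans ?_ (hψz k).le
    have : 1 / ((k : ℝ) + 2) ≤ 1 / 2 :=
      one_div_le_one_div_of_le (by norm_num) (by linarith [Nat.cast_nonneg (α := ℝ) k])
    linarith
  have hwlim : Tendsto (fun k => ‖ψ (z k)‖) atTop (𝓝 1) := by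
    refine tendsto_of_tendsto_of_tendsto_of_le_of_le ?_ tendsto_const_nhds (fun k => (hψz k).le)
      fun k => (hw1 k).le
    have h1 : Tendsto (fun k : ℕ => 1 / ((k : ℝ) + 2)) atTop (𝓝 0) :=
      tendsto_const_nhds.div_atTop
        (tendsto_atTop_add_const_right _ _ tendsto_natCast_atTop_atTop)
    simpa using h1.const_sub 1
  set f : ℕ → mixedNormSpace p q φ hp hq hφ := fun k =>
    ⟨F (ψ (z k)), (hF _ (hw1 k)).1, (hF _ (hw1 k)).2.trans_lt ENNReal.ofReal_lt_top⟩ with hf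
  obtain ⟨h, s, hs, hlim⟩ := hS (K ^ (1 / p)) f fun k =>
    mixedNorm_le_of_mixedNormPow_le hp hK.le (hF _ (hw1 k)).2
  set E : ℕ → ℝ≥0∞ := fun j => blochNorm μ (S (f (s j)) - h : blochSpace μ)
  set d : ℕ → ℕ → ℝ≥0∞ := fun i j => ENNReal.ofReal (μ (‖z (s i)‖ : ℂ)) *
    ‖iteratedDeriv n (f (s j) : ℂ → ℂ) (ψ (z (s i))) * g (z (s i))‖ₑ
  -- At the fixed point ψ(z_i), the n-th derivatives of the later kernels tend to 0.
  have hd : ∀ i, Tendsto (d i) atTop (𝓝 0) := by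
    intro i
    have h1 : Tendsto (fun j => iteratedDeriv n (f (s j) : ℂ → ℂ) (ψ (z (s i)))) atTop (𝓝 0) :=
      (hFlim _ (hw1 _) _ hw1 hwlim).comp hs.tendsto_atTop
    have h2 := (h1.mul_const (g (z (s i)))).enorm
    rw [zero_mul, enorm_zero] at h2
    have h3 := ENNReal.Tendsto.const_mul (a := ENNReal.ofReal (μ (‖z (s i)‖ : ℂ))) h2
      (Or.inr ENNReal.ofReal_ne_top)
    rwa [mul_zero] at h3
  have hkey : ∀ i j, ENNReal.ofReal c * M ≤ ENNReal.ofReal K₂ * A + E i + E j + d i j := by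
    intro i j
    refine le_trans ?_ (ofReal_mul_enorm_deriv_le_of_sub hp hq hφ hψ hg S h (f (s i)) (f (s j))
      hK₂0 ?_ (hz (s i)))
    · set w := ψ (z (s i)) with hw
      have hφw := hb.pos ‖w‖ ⟨norm_nonneg _, hw1 _⟩
      have hG := hb.growthWeight_pos q n (norm_nonneg w) (hw1 _)
      have hμ0 : 0 ≤ μ (‖z (s i)‖ : ℂ) := (hμ.2 _ (by simpa using hz (s i))).le
      calc ENNReal.ofReal c * M ≤ ENNReal.ofReal c * ENNReal.ofReal (μ (‖z (s i)‖ : ℂ) *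
            ‖g (z (s i))‖ / (φ ‖w‖ * (1 - ‖w‖ ^ 2) ^ (1 / q + (n : ℝ)))) := by
            gcongr
            exact (hval _).le
        _ ≤ ENNReal.ofReal (μ (‖z (s i)‖ : ℂ) *
            (‖iteratedDeriv n (F w) w‖ * ‖g (z (s i))‖)) := by
            rw [← ENNReal.ofReal_mul hc.le]
            refine ENNReal.ofReal_le_ofReal ?_
            calc _ ≤ c * (μ (‖z (s i)‖ : ℂ) * ‖g (z (s i))‖ / growthWeight q φ n ‖w‖) := by
                  gcongr
                  exact growthWeight_le hq n (norm_nonneg w) (hw1 _) hφw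
              _ = μ (‖z (s i)‖ : ℂ) * ((c / growthWeight q φ n ‖w‖) * ‖g (z (s i))‖) := by ring
              _ ≤ _ := by
                  gcongr
                  rw [div_le_iff₀ hG]
                  exact hFlow w (hw2 _) (hw1 _)
        _ = _ := by
            rw [ENNReal.ofReal_mul hμ0, ← norm_mul, ofReal_norm]
    · refine mixedNorm_le_of_mixedNormPow_le hp (by positivity) ?_
      refine (mixedNormPow_sub_le hp hq hφ (f (s i)).2.1 (f (s j)).2.1).trans ?_
      rw [← hQ, ENNReal.ofReal_mul (p := Q) (by positivity), ENNReal.ofReal_add hK.le hK.le]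
      gcongr
      · exact (hF _ (hw1 _)).2
      · exact (hF _ (hw1 _)).2
  -- The order of the limits matters: d i j tends to 0 in j for fixed i, so j goes first; E i is
  -- removed afterwards.
  have hlimj : ∀ i, ENNReal.ofReal c * M ≤ ENNReal.ofReal K₂ * A + E i := by
    intro i
    have h1 : Tendsto (fun j => ENNReal.ofReal K₂ * A + E i + E j + d i j) atTop
        (𝓝 (ENNReal.ofReal K₂ * A + E i + 0 + 0)) := (tendsto_const_nhds.add hlim).add (hd i)
    rw [add_zero, add_zero] at h1
    exact ge_of_tendsto' h1 (hkey i)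
  have hlimi : ENNReal.ofReal c * M ≤ ENNReal.ofReal K₂ * A := by
    have h1 : Tendsto (fun i => ENNReal.ofReal K₂ * A + E i) atTop
        (𝓝 (ENNReal.ofReal K₂ * A + 0)) := tendsto_const_nhds.add hlim
    rw [add_zero] at h1
    exact ge_of_tendsto' h1 hlimj
  calc M = ENNReal.ofReal c⁻¹ * (ENNReal.ofReal c * M) := by
        rw [← mul_assoc, ← ENNReal.ofReal_mul (by positivity), inv_mul_cancel₀ hc.ne',
          ENNReal.ofReal_one, one_mul]
    _ ≤ ENNReal.ofReal c⁻¹ * (ENNReal.ofReal K₂ * A) := by gcongr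
    _ = _ := by
        rw [← mul_assoc, ← ENNReal.ofReal_mul (by positivity), inv_mul_eq_div]

/-! ### Operators of finite rank into the Bloch space -/

theorem blochNorm_add_le {μ : ℂ → ℝ} (f g : blochSpace μ) :
    blochNorm μ (f + g : blochSpace μ) ≤ blochNorm μ f + blochNorm μ g := by
  rw [Submodule.coe_add]
  conv_lhs => rw [blochNorm]
  calc _ ≤ (‖(f : ℂ → ℂ) 0‖ₑ + ‖(g : ℂ → ℂ) 0‖ₑ) +
        ((⨆ z ∈ Metric.ball (0 : ℂ) 1, ENNReal.ofReal (μ (‖z‖ : ℂ)) * ‖deriv (f : ℂ → ℂ) z‖ₑ) +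
        ⨆ z ∈ Metric.ball (0 : ℂ) 1, ENNReal.ofReal (μ (‖z‖ : ℂ)) * ‖deriv (g : ℂ → ℂ) z‖ₑ) := by
        refine add_le_add (enorm_add_le _ _) (iSup₂_le fun z hz => ?_)
        have hz' := mem_ball_zero_iff.1 hz
        rw [deriv_add (differentiableAt_of_mem_blochSpace f hz')
          (differentiableAt_of_mem_blochSpace g hz')]
        refine (mul_le_mul_right (enorm_add_le _ _) _).trans ?_
        rw [mul_add]
        exact add_le_add
          (le_iSup₂ (f := fun z (_ : z ∈ Metric.ball (0 : ℂ) 1) =>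
            ENNReal.ofReal (μ (‖z‖ : ℂ)) * ‖deriv (f : ℂ → ℂ) z‖ₑ) z hz)
          (le_iSup₂ (f := fun z (_ : z ∈ Metric.ball (0 : ℂ) 1) =>
            ENNReal.ofReal (μ (‖z‖ : ℂ)) * ‖deriv (g : ℂ → ℂ) z‖ₑ) z hz)
    _ = _ := by rw [add_add_add_comm]; rfl

theorem blochNorm_smul_le {μ : ℂ → ℝ} (c : ℂ) (f : blochSpace μ) :
    blochNorm μ (c • f : blochSpace μ) ≤ ‖c‖ₑ * blochNorm μ f := by
  rw [Submodule.coe_smul, blochNorm, blochNorm, mul_add, Pi.smul_apply, enorm_smul]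
  refine add_le_add le_rfl (iSup₂_le fun z hz => ?_)
  rw [deriv_const_smul c (differentiableAt_of_mem_blochSpace f (mem_ball_zero_iff.1 hz)),
    enorm_smul, mul_left_comm]
  exact mul_le_mul_right
    (le_iSup₂ (f := fun z (_ : z ∈ Metric.ball (0 : ℂ) 1) =>
      ENNReal.ofReal (μ (‖z‖ : ℂ)) * ‖deriv (f : ℂ → ℂ) z‖ₑ) z hz) _

theorem blochNorm_zero (μ : ℂ → ℝ) : blochNorm μ (0 : blochSpace μ) = 0 := by
  simp [blochNorm]

theorem blochNorm_sum_smul_le {μ : ℂ → ℝ} {ι : Type*} (s : Finset ι) (c : ι → ℂ)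
    (v : ι → blochSpace μ) :
    blochNorm μ (∑ k ∈ s, c k • v k : blochSpace μ) ≤ ∑ k ∈ s, ‖c k‖ₑ * blochNorm μ (v k) := by
  classical
  induction s using Finset.induction_on with
  | empty => simp only [Finset.sum_empty]; exact (blochNorm_zero μ).le
  | insert k s hk ih =>
    rw [Finset.sum_insert hk, Finset.sum_insert hk]
    exact (blochNorm_add_le _ _).trans (add_le_add (blochNorm_smul_le _ _) ih)

/-- An operator of finite rank whose coefficient functionals are bounded is compact. -/
theorem isCompactMixedToBloch_sum_smulRight {p q : ℝ} {φ : ℝ → ℝ} (hp : 0 < p) (hq : 0 < q)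
    (hφ : IsNormalFunction φ) {μ : ℂ → ℝ} {ι : Type*} [Fintype ι]
    (ℓ : ι → mixedNormSpace p q φ hp hq hφ →ₗ[ℂ] ℂ) (v : ι → blochSpace μ)
    (hℓ : ∀ k, ∀ M : ℝ, ∃ B : ℝ, ∀ f : mixedNormSpace p q φ hp hq hφ,
      mixedNorm p q φ f ≤ ENNReal.ofReal M → ‖ℓ k f‖ ≤ B) :
    IsCompactMixedToBloch p q φ hp hq hφ μ (∑ k, (ℓ k).smulRight (v k)) := by
  intro M f hf
  choose B hB using fun k => hℓ k M
  have hmem : ∀ j, (fun k => ℓ k (f j)) ∈ Set.pi univ fun k => Metric.closedBall (0 : ℂ) (B k) :=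
    fun j k _ => mem_closedBall_zero_iff.2 (hB k _ (hf j))
  -- Bolzano–Weierstrass for the coefficient vectors, which lie in a bounded subset of a finite
  -- power of ℂ.
  obtain ⟨y, -, s, hs, hlim⟩ := tendsto_subseq_of_bounded
    (Bornology.IsBounded.pi fun k => Metric.isBounded_closedBall) hmem
  refine ⟨∑ k, y k • v k, s, hs, ?_⟩
  have heq : ∀ j, ((∑ k, (ℓ k).smulRight (v k)) (f (s j)) - ∑ k, y k • v k : blochSpace μ) =
      ∑ k, (ℓ k (f (s j)) - y k) • v k := fun j => by
    simp only [LinearMap.sum_apply, LinearMap.smulRight_apply]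
    rw [← Finset.sum_sub_distrib]
    exact Finset.sum_congr rfl fun k _ => (sub_smul _ _ _).symm
  simp_rw [heq]
  refine tendsto_of_tendsto_of_tendsto_of_le_of_le tendsto_const_nhds ?_ (fun j => zero_le)
    fun j => blochNorm_sum_smul_le Finset.univ _ v
  rw [← Finset.sum_const_zero (s := Finset.univ) (ι := ι)]
  refine tendsto_finsetSum _ fun k _ => ?_
  have h1 : Tendsto (fun j => ℓ k (f (s j)) - y k) atTop (𝓝 0) := by
    simpa using ((tendsto_pi_nhds.1 hlim k).sub_const (y k))
  have h2 := h1.enorm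
  rw [enorm_zero] at h2
  have h3 := ENNReal.Tendsto.mul_const (b := blochNorm μ (v k)) h2 (Or.inr (v k).2.2.ne)
  rwa [zero_mul] at h3

/-! ### Approximation by Taylor polynomials of dilations -/

/-- The Taylor coefficients at `0`. -/
noncomputable def taylorCoeff (k : ℕ) (f : ℂ → ℂ) : ℂ :=
  (k.factorial : ℂ)⁻¹ * iteratedDeriv k f 0

theorem norm_taylorCoeff_le {f : ℂ → ℂ} (hf : f ∈ discAnalytic) (k : ℕ) {s B : ℝ} (hs0 : 0 < s)
    (hs1 : s < 1) (hB : ∀ z, ‖z‖ = s → ‖f z‖ ≤ B) : ‖taylorCoeff k f‖ ≤ B / s ^ k := by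
  have h := Complex.norm_iteratedDeriv_le_of_forall_mem_sphere_norm_le (f := f) (c := 0) k hs0
    (C := B) (DifferentiableOn.diffContOnCl (hf.1.mono fun z hz => by
      rw [closure_ball _ hs0.ne'] at hz
      exact Metric.closedBall_subset_ball hs1 hz)) fun z hz => hB z (mem_sphere_zero_iff_norm.1 hz)
  have hk : (0 : ℝ) < k.factorial := by exact_mod_cast k.factorial_pos
  rw [taylorCoeff, norm_mul, norm_inv, Complex.norm_natCast, inv_mul_le_iff₀ hk]
  exact h.trans_eq (by ring)

theorem iteratedDeriv_sum_mul_pow (a : ℕ → ℂ) (N n : ℕ) (z : ℂ) :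
    iteratedDeriv n (fun ζ => ∑ k ∈ Finset.range N, a k * ζ ^ k) z =
      ∑ k ∈ Finset.range N, a k * iteratedDeriv n (fun ζ => ζ ^ k) z := by
  rw [iteratedDeriv_fun_sum fun k _ => by fun_prop]
  exact Finset.sum_congr rfl fun k _ => iteratedDeriv_const_mul_field _ _

/-- Both sides are the n-th derivative at z of ζ ↦ (ρζ)^k; for k < n both vanish. -/
theorem pow_mul_iteratedDeriv_pow (ρ z : ℂ) (k n : ℕ) :
    ρ ^ n * iteratedDeriv n (fun ζ : ℂ => ζ ^ k) (ρ * z) =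
      ρ ^ k * iteratedDeriv n (fun ζ => ζ ^ k) z := by
  simp only [iteratedDeriv_pow]
  rcases le_or_gt n k with h | h
  · rw [mul_pow, ← Nat.add_sub_cancel' h, Nat.add_sub_cancel_left, pow_add]
    ring
  · simp [Nat.descFactorial_of_lt h]

/-- Taylor polynomials of the dilations approximate the derivatives of the dilations uniformly on
the disc and uniformly over all functions with a common bound on each smaller disc. -/
theorem exists_taylor_dilation_le (n : ℕ) {ρ η : ℝ} (hρ0 : 0 < ρ) (hρ1 : ρ < 1) (hη : 0 < η)
    (B : ℝ → ℝ) :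
    ∃ N : ℕ, ∀ f ∈ discAnalytic, (∀ s : ℝ, 0 < s → s < 1 → ∀ z, ‖z‖ = s → ‖f z‖ ≤ B s) →
      ∀ w : ℂ, ‖w‖ < 1 → ‖(ρ : ℂ) ^ n * iteratedDeriv n f (ρ * w) -
        ∑ k ∈ Finset.range N, (ρ : ℂ) ^ k * taylorCoeff k f *
          iteratedDeriv n (fun ζ => ζ ^ k) w‖ ≤ η := by
  -- Three nested radii ρ < σ < s < 1: the coefficients are bounded on |z| = s, the Taylor tail is
  -- then geometric of ratio σ/s on |z| ≤ σ, and Cauchy's estimate on circles of radius δ = σ - ρ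
  -- passes to derivatives on |z| ≤ ρ.
  set δ : ℝ := (1 - ρ) / 4 with hδ
  have hδ0 : 0 < δ := by rw [hδ]; linarith
  set σ : ℝ := ρ + δ with hσ
  set s : ℝ := ρ + 2 * δ with hs
  have hs0 : 0 < s := by positivity
  have hs1 : s < 1 := by linarith
  have hσ0 : 0 < σ := by positivity
  have hσs : σ / s < 1 := by rw [div_lt_one hs0]; linarith
  have hσs' : 0 < 1 - σ / s := by linarith
  have hlim : Tendsto (fun N : ℕ => (n.factorial : ℝ) * (|B s| * (σ / s) ^ N / (1 - σ / s)) / δ ^ n)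
      atTop (𝓝 0) := by
    have h1 := tendsto_pow_atTop_nhds_zero_of_lt_one (by positivity : 0 ≤ σ / s) hσs
    simpa using ((((h1.const_mul |B s|).div_const (1 - σ / s)).const_mul
      (n.factorial : ℝ)).div_const (δ ^ n))
  -- N is chosen before f: the tail bound involves f only through the common bound B(s).
  obtain ⟨N, hN⟩ := (hlim.eventually (gt_mem_nhds hη)).exists
  refine ⟨N, fun f hf hB w hw => ?_⟩
  set P : ℂ → ℂ := fun ζ => ∑ k ∈ Finset.range N, taylorCoeff k f * ζ ^ k with hP
  have hPd : Differentiable ℂ P := by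
    rw [hP]
    fun_prop
  have htail : ∀ ζ : ℂ, ‖ζ‖ ≤ σ → ‖f ζ - P ζ‖ ≤ |B s| * (σ / s) ^ N / (1 - σ / s) := by
    intro ζ hζ
    have hsum : HasSum (fun k => taylorCoeff k f * ζ ^ k) (f ζ) := by
      have := Complex.hasSum_taylorSeries_on_ball hf.1
        (mem_ball_zero_iff.2 (hζ.trans_lt (by linarith : σ < 1)))
      refine this.congr_fun fun k => ?_
      rw [taylorCoeff, sub_zero, smul_eq_mul, smul_eq_mul]
      ring
    have hterm : ∀ k, ‖taylorCoeff k f * ζ ^ k‖ ≤ |B s| * (σ / s) ^ k := fun k => by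
      have h1 : ‖taylorCoeff k f‖ ≤ |B s| / s ^ k := norm_taylorCoeff_le hf k hs0 hs1
        fun z hz => (hB s hs0 hs1 z hz).trans (le_abs_self _)
      rw [norm_mul, norm_pow, div_pow]
      calc _ ≤ |B s| / s ^ k * σ ^ k := by gcongr
        _ = _ := by ring
    have := norm_sub_le_of_geometric_bound_of_hasSum hσs hterm hsum N
    rwa [norm_sub_rev] at this
  have hρw : ‖(ρ : ℂ) * w‖ ≤ ρ := by
    rw [norm_mul, Complex.norm_real, Real.norm_of_nonneg hρ0.le]
    exact mul_le_of_le_one_right hρ0.le hw.le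
  have hball : ∀ z, ‖z - ρ * w‖ ≤ δ → ‖z‖ ≤ σ := fun z hz => by
    have h2 := norm_add_le (ρ * w : ℂ) (z - ρ * w)
    rw [add_sub_cancel] at h2
    linarith
  have hC := Complex.norm_iteratedDeriv_le_of_forall_mem_sphere_norm_le (f := f - P)
    (c := (ρ : ℂ) * w) n hδ0 (C := |B s| * (σ / s) ^ N / (1 - σ / s))
    (DifferentiableOn.diffContOnCl ((hf.1.mono fun z hz => by
      rw [closure_ball _ hδ0.ne', mem_closedBall_iff_norm] at hz
      rw [mem_ball_zero_iff]
      exact (hball z hz).trans_lt (by linarith)).sub hPd.differentiableOn)) fun z hz =>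
      htail z (hball z (mem_sphere_iff_norm.1 hz).le)
  have hsub : (ρ : ℂ) ^ n * iteratedDeriv n f (ρ * w) -
        ∑ k ∈ Finset.range N, (ρ : ℂ) ^ k * taylorCoeff k f * iteratedDeriv n (fun ζ => ζ ^ k) w =
      (ρ : ℂ) ^ n * iteratedDeriv n (f - P) (ρ * w) := by
    rw [iteratedDeriv_sub (contDiffAt_of_mem_discAnalytic hf n (hρw.trans_lt hρ1))
      hPd.contDiff.contDiffAt, hP, iteratedDeriv_sum_mul_pow, mul_sub, Finset.mul_sum]
    congr 1
    refine Finset.sum_congr rfl fun k _ => ?_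
    rw [mul_left_comm, pow_mul_iteratedDeriv_pow]
    ring
  rw [hsub, norm_mul, norm_pow, Complex.norm_real, Real.norm_of_nonneg hρ0.le]
  calc _ ≤ 1 * ‖iteratedDeriv n (f - P) (ρ * w)‖ := by
        gcongr
        exact pow_le_one₀ hρ0.le hρ1.le
    _ ≤ η := by rw [one_mul]; exact hC.trans hN.le

/-- On compact subsets of the disc the derivatives of a function in the unit ball of `H(p, q, φ)`
are uniformly close to those of its dilations. -/
theorem NormalBounds.exists_dilation_le {p q : ℝ} (hp : 0 < p) (hq : 0 < q) {φ : ℝ → ℝ} {a b : ℝ}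
    (hφ : NormalBounds φ a b) (n : ℕ) {R η : ℝ} (hR0 : 0 ≤ R) (hR1 : R < 1) (hη : 0 < η) :
    ∃ ρ : ℝ, 0 < ρ ∧ ρ < 1 ∧ ∀ f ∈ discAnalytic, mixedNorm p q φ f ≤ 1 → ∀ w : ℂ, ‖w‖ ≤ R →
      ‖iteratedDeriv n f w - (ρ : ℂ) ^ n * iteratedDeriv n f (ρ * w)‖ ≤ η := by
  obtain ⟨C₀, hC₀, hC₀b⟩ := hφ.exists_norm_iteratedDeriv_mul_growthWeight_le hp hq n
  obtain ⟨C₁, hC₁, hC₁b⟩ := hφ.exists_norm_iteratedDeriv_mul_growthWeight_le hp hq (n + 1)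
  have hG₀ := hφ.growthWeight_pos q n hR0 hR1
  have hG₁ := hφ.growthWeight_pos q (n + 1) hR0 hR1
  set B₀ := C₀ / growthWeight q φ n R
  set B₁ := C₁ / growthWeight q φ (n + 1) R
  have hB₀ : 0 < B₀ := by positivity
  have hB₁ : 0 < B₁ := by positivity
  -- B₁(1-ρ) is the Lipschitz bound for moving the point from w to ρw; (1-ρⁿ)B₀ pays for the factor
  -- ρⁿ.
  have hcont : Tendsto (fun ρ : ℝ => B₁ * (1 - ρ) + (1 - ρ ^ n) * B₀) (𝓝[<] 1) (𝓝 0) := by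
    have : Continuous fun ρ : ℝ => B₁ * (1 - ρ) + (1 - ρ ^ n) * B₀ := by fun_prop
    have h := (this.tendsto 1).mono_left (nhdsWithin_le_nhds (s := Iio 1))
    simpa using h
  obtain ⟨ρ, hρη, hρ0, hρ1⟩ := ((hcont.eventually (gt_mem_nhds hη)).and
    (Ioo_mem_nhdsLT (zero_lt_one (α := ℝ)))).exists
  refine ⟨ρ, hρ0, hρ1, fun f hf hf1 w hw => ?_⟩
  rw [← ENNReal.ofReal_one] at hf1
  have hb₀ : ∀ z : ℂ, ‖z‖ ≤ R → ‖iteratedDeriv n f z‖ ≤ B₀ := fun z hz => by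
    rw [le_div_iff₀ hG₀, ← mul_one C₀]
    exact (mul_le_mul_of_nonneg_left (hφ.growthWeight_anti hq n (norm_nonneg _) hz hR1)
      (norm_nonneg _)).trans (hC₀b f hf 1 zero_le_one hf1 z (hz.trans_lt hR1))
  have hb₁ : ∀ z : ℂ, ‖z‖ ≤ R → ‖deriv (iteratedDeriv n f) z‖ ≤ B₁ := fun z hz => by
    rw [← iteratedDeriv_succ, le_div_iff₀ hG₁, ← mul_one C₁]
    exact (mul_le_mul_of_nonneg_left (hφ.growthWeight_anti hq (n + 1) (norm_nonneg _) hz hR1)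
      (norm_nonneg _)).trans (hC₁b f hf 1 zero_le_one hf1 z (hz.trans_lt hR1))
  have hρw : ‖(ρ : ℂ) * w‖ ≤ R := by
    rw [norm_mul, Complex.norm_real, Real.norm_of_nonneg hρ0.le]
    exact (mul_le_of_le_one_left (norm_nonneg _) hρ1.le).trans hw
  have hlip := (convex_closedBall (0 : ℂ) R).norm_image_sub_le_of_norm_deriv_le
    (f := iteratedDeriv n f) (C := B₁) (x := (ρ : ℂ) * w) (y := w)
    (fun z hz => (differentiableOn_iteratedDeriv hf n).differentiableAt
      (Metric.isOpen_ball.mem_nhds (Metric.closedBall_subset_ball hR1 hz)))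
    (fun z hz => hb₁ z (mem_closedBall_zero_iff.1 hz)) (mem_closedBall_zero_iff.2 hρw)
    (mem_closedBall_zero_iff.2 hw)
  have hw' : ‖w - ρ * w‖ ≤ 1 - ρ := by
    rw [show w - ρ * w = ((1 - ρ : ℝ) : ℂ) * w by push_cast; ring, norm_mul, Complex.norm_real,
      Real.norm_of_nonneg (by linarith)]
    exact mul_le_of_le_one_right (by linarith) (hw.trans hR1.le)
  have hρn : ρ ^ n ≤ 1 := pow_le_one₀ hρ0.le hρ1.le
  calc ‖iteratedDeriv n f w - (ρ : ℂ) ^ n * iteratedDeriv n f (ρ * w)‖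
      = ‖(iteratedDeriv n f w - iteratedDeriv n f (ρ * w)) +
        ((1 - ρ ^ n : ℝ) : ℂ) * iteratedDeriv n f (ρ * w)‖ := by
        congr 1
        push_cast
        ring
    _ ≤ B₁ * ‖w - ρ * w‖ + (1 - ρ ^ n) * ‖iteratedDeriv n f (ρ * w)‖ := by
        refine (norm_add_le _ _).trans (add_le_add hlip ?_)
        rw [norm_mul, Complex.norm_real, Real.norm_of_nonneg (by linarith)]
    _ ≤ B₁ * (1 - ρ) + (1 - ρ ^ n) * B₀ := by
        gcongr
        exact hb₀ _ hρw
    _ ≤ η := hρη.le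

/-- The unit ball of `H(p, q, φ)` is approximated by operators of finite rank with values in the
polynomials: on compact subsets with an arbitrarily small error, and on the whole disc with an error
of the order of the growth estimate. -/
theorem NormalBounds.exists_approximation {p q : ℝ} (hp : 0 < p) (hq : 0 < q) {φ : ℝ → ℝ} {a b : ℝ}
    (hφ : NormalBounds φ a b) (n : ℕ) :
    ∃ C : ℝ, 0 < C ∧ ∀ R η : ℝ, 0 ≤ R → R < 1 → 0 < η → ∃ (ρ : ℝ) (N : ℕ),
      ∀ f ∈ discAnalytic, mixedNorm p q φ f ≤ 1 → ∀ w : ℂ, ‖w‖ < 1 →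
        ‖iteratedDeriv n f w - ∑ k ∈ Finset.range N, (ρ : ℂ) ^ k * taylorCoeff k f *
          iteratedDeriv n (fun ζ => ζ ^ k) w‖ ≤ C / growthWeight q φ n ‖w‖ + η ∧
        (‖w‖ ≤ R → ‖iteratedDeriv n f w - ∑ k ∈ Finset.range N, (ρ : ℂ) ^ k * taylorCoeff k f *
          iteratedDeriv n (fun ζ => ζ ^ k) w‖ ≤ η) := by
  obtain ⟨C, hC, hCb⟩ := hφ.exists_norm_iteratedDeriv_mul_growthWeight_le hp hq n
  obtain ⟨C₀, hC₀, hC₀b⟩ := hφ.exists_norm_iteratedDeriv_mul_growthWeight_le hp hq 0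
  refine ⟨C + C, by positivity, fun R η hR0 hR1 hη => ?_⟩
  obtain ⟨ρ, hρ0, hρ1, hdil⟩ := hφ.exists_dilation_le hp hq n hR0 hR1 (half_pos hη)
  -- The bounds common to the unit ball on smaller circles are the growth estimate for n = 0.
  obtain ⟨N, hN⟩ := exists_taylor_dilation_le n hρ0 hρ1 (half_pos hη)
    fun s => C₀ / growthWeight q φ 0 s
  refine ⟨ρ, N, fun f hf hf1 w hw => ?_⟩
  have hf1' := hf1
  rw [← ENNReal.ofReal_one] at hf1'
  have hpoly := hN f hf (fun s hs0 hs1 z hz => by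
    rw [le_div_iff₀ (hφ.growthWeight_pos q 0 hs0.le hs1), ← mul_one C₀, ← hz]
    simpa using hC₀b f hf 1 zero_le_one hf1' z (hz ▸ hs1)) w hw
  have hG := hφ.growthWeight_pos q n (norm_nonneg w) hw
  have hρw : ‖(ρ : ℂ) * w‖ ≤ ‖w‖ := by
    rw [norm_mul, Complex.norm_real, Real.norm_of_nonneg hρ0.le]
    exact mul_le_of_le_one_left (norm_nonneg _) hρ1.le
  have hbd : ∀ z : ℂ, ‖z‖ ≤ ‖w‖ → ‖iteratedDeriv n f z‖ ≤ C / growthWeight q φ n ‖w‖ := by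
    intro z hz
    rw [le_div_iff₀ hG, ← mul_one C]
    exact (mul_le_mul_of_nonneg_left (hφ.growthWeight_anti hq n (norm_nonneg _) hz hw)
      (norm_nonneg _)).trans (hCb f hf 1 zero_le_one hf1' z (hz.trans_lt hw))
  set T := ∑ k ∈ Finset.range N, (ρ : ℂ) ^ k * taylorCoeff k f * iteratedDeriv n (fun ζ => ζ ^ k) w
  have htri : ‖iteratedDeriv n f w - T‖ ≤
      ‖iteratedDeriv n f w - (ρ : ℂ) ^ n * iteratedDeriv n f (ρ * w)‖ + η / 2 := by
    rw [← sub_add_sub_cancel _ ((ρ : ℂ) ^ n * iteratedDeriv n f (ρ * w)) T]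
    exact (norm_add_le _ _).trans (add_le_add le_rfl hpoly)
  refine ⟨htri.trans ?_, fun hwR => htri.trans ?_⟩
  -- As |ρw| ≤ |w| and the growth weight decreases, the dilation obeys the same bound at w as f
  -- does. This makes the constant C + C independent of ρ, R and η.
  · have h1 : ‖(ρ : ℂ) ^ n * iteratedDeriv n f (ρ * w)‖ ≤ C / growthWeight q φ n ‖w‖ := by
      rw [norm_mul, norm_pow, Complex.norm_real, Real.norm_of_nonneg hρ0.le]
      exact (mul_le_of_le_one_left (norm_nonneg _) (pow_le_one₀ hρ0.le hρ1.le)).trans (hbd _ hρw)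
    have h2 := norm_sub_le (iteratedDeriv n f w) ((ρ : ℂ) ^ n * iteratedDeriv n f (ρ * w))
    have h3 := hbd w le_rfl
    rw [add_div]
    linarith
  · linarith [hdil f hf hf1 w hwR]

/-! ### Taylor functionals and monomials -/

theorem taylorCoeff_add (k : ℕ) {f g : ℂ → ℂ} (hf : f ∈ discAnalytic) (hg : g ∈ discAnalytic) :
    taylorCoeff k (f + g) = taylorCoeff k f + taylorCoeff k g := by
  have h0 : ‖(0 : ℂ)‖ < 1 := by simp
  simp only [taylorCoeff]
  rw [iteratedDeriv_add (contDiffAt_of_mem_discAnalytic hf k h0)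
    (contDiffAt_of_mem_discAnalytic hg k h0), mul_add]

theorem taylorCoeff_smul (k : ℕ) (c : ℂ) (f : ℂ → ℂ) :
    taylorCoeff k (c • f) = c * taylorCoeff k f := by
  simp only [taylorCoeff]
  rw [iteratedDeriv_const_smul_field, smul_eq_mul, mul_left_comm]

/-- The multiple `c` of a Taylor coefficient as a linear functional on `H(p, q, φ)`. -/
noncomputable def taylorFunctional {p q : ℝ} {φ : ℝ → ℝ} (hp : 0 < p) (hq : 0 < q)
    (hφ : IsNormalFunction φ) (c : ℂ) (k : ℕ) : mixedNormSpace p q φ hp hq hφ →ₗ[ℂ] ℂ where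
  toFun f := c * taylorCoeff k f
  map_add' f g := by rw [Submodule.coe_add, taylorCoeff_add k f.2.1 g.2.1, mul_add]
  map_smul' d f := by
    rw [Submodule.coe_smul, taylorCoeff_smul, RingHom.id_apply, smul_eq_mul, mul_left_comm]

theorem exists_norm_taylorFunctional_le {p q : ℝ} {φ : ℝ → ℝ} (hp : 0 < p) (hq : 0 < q)
    (hφ : IsNormalFunction φ) (c : ℂ) (k : ℕ) (M : ℝ) :
    ∃ B : ℝ, ∀ f : mixedNormSpace p q φ hp hq hφ,
      mixedNorm p q φ f ≤ ENNReal.ofReal M → ‖taylorFunctional hp hq hφ c k f‖ ≤ B := by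
  obtain ⟨a, b, hb⟩ := hφ.exists_normalBounds
  obtain ⟨C, -, hCb⟩ := hb.exists_norm_iteratedDeriv_mul_growthWeight_le hp hq k
  have hG := hb.growthWeight_pos q k le_rfl one_pos
  -- Growth estimate at the origin. It asks for a nonnegative bound, hence `max M 0`;
  -- `ENNReal.ofReal` does not see the change.
  refine ⟨‖c‖ * (‖(k.factorial : ℂ)⁻¹‖ * (C * max M 0 / growthWeight q φ k 0)), fun f hf => ?_⟩
  have h := hCb f f.2.1 (max M 0) (le_max_right _ _)
    (hf.trans (ENNReal.ofReal_le_ofReal (le_max_left _ _))) 0 (by simp)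
  rw [norm_zero] at h
  change ‖c * ((k.factorial : ℂ)⁻¹ * iteratedDeriv k (f : ℂ → ℂ) 0)‖ ≤ _
  rw [norm_mul, norm_mul]
  gcongr
  rwa [le_div_iff₀ hG]

/-- The monomials, as elements of `H(p, q, φ)`. -/
noncomputable def discMonomial (k : ℕ) : ℂ → ℂ :=
  (Metric.ball (0 : ℂ) 1).indicator fun ζ => ζ ^ k

theorem discMonomial_mem_mixedNormSpace {p q : ℝ} {φ : ℝ → ℝ} (hp : 0 < p) (hq : 0 < q)
    (hφ : IsNormalFunction φ) (k : ℕ) : discMonomial k ∈ mixedNormSpace p q φ hp hq hφ := by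
  refine mem_mixedNormSpace_of_norm_le hp hq hφ
    (indicator_ball_mem_discAnalytic (by fun_prop)) (B := 1) fun z hz => ?_
  rw [discMonomial, indicator_of_mem (mem_ball_zero_iff.2 hz), norm_pow]
  exact pow_le_one₀ (norm_nonneg _) hz.le

theorem iteratedDeriv_discMonomial (n k : ℕ) {w : ℂ} (hw : ‖w‖ < 1) :
    iteratedDeriv n (discMonomial k) w = iteratedDeriv n (fun ζ => ζ ^ k) w :=
  iteratedDeriv_indicator_ball _ n hw

/-! ### The upper bound -/

/-- Test on ζⁿ: its n-th derivative is the constant n! ≥ 1, so the image has derivative n!·g. -/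
theorem IsBoundedMixedToBloch.exists_mul_norm_le {p q : ℝ} {φ : ℝ → ℝ} (hp : 0 < p) (hq : 0 < q)
    (hφ : IsNormalFunction φ) {n : ℕ} {μ : ℂ → ℝ} {ψ g : ℂ → ℂ} (hμ : IsWeight μ)
    (hψ : IsAnalyticSelfMap ψ) (hg : DifferentiableOn ℂ g (Metric.ball 0 1))
    (hT : IsBoundedMixedToBloch p q φ hp hq hφ μ (genIntegrationOp n ψ g)) :
    ∃ B : ℝ, 0 < B ∧ ∀ z : ℂ, ‖z‖ < 1 → μ (‖z‖ : ℂ) * ‖g z‖ ≤ B := by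
  obtain ⟨K, hK⟩ := hT
  have he := discMonomial_mem_mixedNormSpace hp hq hφ n
  have hfin := (hK _ he).1.2
  refine ⟨(blochNorm μ (genIntegrationOp n ψ g (discMonomial n))).toReal + 1, by positivity,
    fun z hz => ?_⟩
  have hzb := mem_ball_zero_iff.2 hz
  have hμ0 : 0 ≤ μ (‖z‖ : ℂ) := (hμ.2 _ (by simpa using hz)).le
  have h1 := ofReal_mul_enorm_deriv_le_blochNorm μ (genIntegrationOp n ψ g (discMonomial n)) hz
  rw [(hasDerivAt_genIntegrationOp n hψ hg he.1 hzb).deriv,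
    iteratedDeriv_discMonomial n n (mem_ball_zero_iff.1 (hψ.2 hzb)), iteratedDeriv_pow,
    Nat.descFactorial_self, Nat.sub_self, pow_zero, mul_one, ← ofReal_norm,
    ← ENNReal.ofReal_mul hμ0] at h1
  have h2 := (ENNReal.ofReal_le_iff_le_toReal hfin.ne).1 h1
  rw [norm_mul, Complex.norm_natCast] at h2
  have hfac : (1 : ℝ) ≤ n.factorial := by exact_mod_cast n.factorial_pos
  have h3 : ‖g z‖ ≤ n.factorial * ‖g z‖ := le_mul_of_one_le_left (norm_nonneg _) hfac
  have h4 := mul_le_mul_of_nonneg_left h3 hμ0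
  linarith

theorem blochNorm_le_of_forall {μ : ℂ → ℝ} {h : ℂ → ℂ} {A : ℝ} (hμ : IsWeight μ) (h0 : h 0 = 0)
    (hA : ∀ z : ℂ, ‖z‖ < 1 → μ (‖z‖ : ℂ) * ‖deriv h z‖ ≤ A) :
    blochNorm μ h ≤ ENNReal.ofReal A := by
  rw [blochNorm, h0, enorm_zero, zero_add]
  refine iSup₂_le fun z hz => ?_
  have hz := mem_ball_zero_iff.1 hz
  rw [← ofReal_norm, ← ENNReal.ofReal_mul (hμ.2 _ (by simpa using hz)).le]
  exact ENNReal.ofReal_le_ofReal (hA z hz)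

theorem exists_radius_of_symbolLimsup_lt {q : ℝ} {φ : ℝ → ℝ} {n : ℕ} {μ : ℂ → ℝ} {ψ g : ℂ → ℂ}
    (hψ : IsAnalyticSelfMap ψ) {l : ℝ} (hl : symbolLimsup q φ n μ ψ g < ENNReal.ofReal l) :
    ∃ R : ℝ, 0 ≤ R ∧ R < 1 ∧ ∀ z : ℂ, ‖z‖ < 1 → R < ‖ψ z‖ →
      μ (‖z‖ : ℂ) * ‖g z‖ / (φ ‖ψ z‖ * (1 - ‖ψ z‖ ^ 2) ^ (1 / q + (n : ℝ))) ≤ l := by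
  have hev := eventually_lt_of_limsup_lt hl (by isBoundedDefault)
  rw [eventually_inf_principal, eventually_comap] at hev
  obtain ⟨R, hR, hRs⟩ := (mem_nhdsLT_iff_exists_Ioo_subset' (zero_lt_one (α := ℝ))).1 hev
  refine ⟨max R 0, le_max_right _ _, max_lt hR one_pos, fun z hz hRz => ?_⟩
  have hzb := mem_ball_zero_iff.2 hz
  have := hRs ⟨(le_max_left _ _).trans_lt hRz, mem_ball_zero_iff.1 (hψ.2 hzb)⟩ z rfl hzb
  exact (ENNReal.ofReal_lt_ofReal_iff'.1 this).1.le

/-- The competitor S sends f to the image under T of the Taylor polynomial of its dilation. The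
pointwise error is split at |ψ(z)| = R, with R so close to 1 that beyond it the quotient is at most
l + ε₁. -/
theorem exists_essentialNorm_le_mul_symbolLimsup {p q : ℝ} (hp : 0 < p) (hq : 0 < q) {φ : ℝ → ℝ}
    (hφ : IsNormalFunction φ) (n : ℕ) :
    ∃ C : ℝ, 0 < C ∧ ∀ (μ : ℂ → ℝ) (ψ g : ℂ → ℂ), IsWeight μ → IsAnalyticSelfMap ψ →
      DifferentiableOn ℂ g (Metric.ball 0 1) →
      IsBoundedMixedToBloch p q φ hp hq hφ μ (genIntegrationOp n ψ g) →
      essentialNorm p q φ hp hq hφ μ (genIntegrationOp n ψ g) ≤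
        ENNReal.ofReal C * symbolLimsup q φ n μ ψ g := by
  obtain ⟨a, b, hb⟩ := hφ.exists_normalBounds
  obtain ⟨C, hC, happ⟩ := hb.exists_approximation hp hq n
  set C' : ℝ := C * 2 ^ (1 / q + (n : ℝ)) with hC'
  have hC'0 : 0 < C' := by positivity
  refine ⟨C', hC'0, fun μ ψ g hμ hψ hg hT => ?_⟩
  rcases eq_or_ne (symbolLimsup q φ n μ ψ g) ∞ with htop | htop
  · rw [htop, ENNReal.mul_top (by simpa using hC'0)]
    exact le_top
  obtain ⟨B, hB, hBb⟩ := hT.exists_mul_norm_le hp hq hφ hμ hψ hg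
  set l := (symbolLimsup q φ n μ ψ g).toReal with hl
  have hl0 : 0 ≤ l := ENNReal.toReal_nonneg
  have hL : symbolLimsup q φ n μ ψ g = ENNReal.ofReal l := (ENNReal.ofReal_toReal htop).symm
  rw [hL, ← ENNReal.ofReal_mul hC'0.le]
  refine ENNReal.le_of_forall_pos_le_add fun ε hε _ => ?_
  have hε' : (0 : ℝ) < ε := hε
  -- The limsup contributes C'ε₁ and the polynomial approximation ε₁, in total ε. The approximation
  -- error is set to ε₁/B because it gets multiplied by μ|g| ≤ B.
  set ε₁ : ℝ := ε / (C' + 1) with hε₁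
  have hε₁0 : 0 < ε₁ := by positivity
  obtain ⟨R, hR0, hR1, hR⟩ := exists_radius_of_symbolLimsup_lt (l := l + ε₁) hψ
    (hL.trans_lt ((ENNReal.ofReal_lt_ofReal_iff (by linarith)).2 (by linarith)))
  obtain ⟨ρ, N, hρN⟩ := happ R (ε₁ / B) hR0 hR1 (by positivity)
  obtain ⟨K, hK⟩ := hT
  set v : Fin N → blochSpace μ := fun k =>
    ⟨genIntegrationOp n ψ g (discMonomial k),
      (hK _ (discMonomial_mem_mixedNormSpace hp hq hφ k)).1⟩ with hv
  set S : mixedNormSpace p q φ hp hq hφ →ₗ[ℂ] blochSpace μ :=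
    ∑ k : Fin N, (taylorFunctional hp hq hφ ((ρ : ℂ) ^ (k : ℕ)) k).smulRight (v k) with hS
  have hScomp : IsCompactMixedToBloch p q φ hp hq hφ μ S :=
    isCompactMixedToBloch_sum_smulRight hp hq hφ _ v fun k M =>
      exists_norm_taylorFunctional_le hp hq hφ _ k M
  have hSapp : ∀ f : mixedNormSpace p q φ hp hq hφ, (S f : ℂ → ℂ) =
      ∑ k ∈ Finset.range N, ((ρ : ℂ) ^ k * taylorCoeff k f) •
        genIntegrationOp n ψ g (discMonomial k) := by
    intro f
    rw [← Fin.sum_univ_eq_sum_range (fun k => ((ρ : ℂ) ^ k * taylorCoeff k f) •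
        genIntegrationOp n ψ g (discMonomial k)), hS, LinearMap.sum_apply,
      AddSubmonoidClass.coe_finsetSum]
    rfl
  refine (iInf₂_le S hScomp).trans (iSup₂_le fun f hf => ?_)
  rw [← ENNReal.ofReal_coe_nnreal, ← ENNReal.ofReal_add (by positivity) hε'.le]
  refine blochNorm_le_of_forall hμ ?_ fun z hz => ?_
  · simp [hSapp, genIntegrationOp_apply_zero]
  have hzb := mem_ball_zero_iff.2 hz
  have hψz : ‖ψ z‖ < 1 := mem_ball_zero_iff.1 (hψ.2 hzb)
  have hμ0 : 0 ≤ μ (‖z‖ : ℂ) := (hμ.2 _ (by simpa using hz)).le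
  set X := iteratedDeriv n (f : ℂ → ℂ) (ψ z) - ∑ k ∈ Finset.range N,
    (ρ : ℂ) ^ k * taylorCoeff k f * iteratedDeriv n (fun ζ => ζ ^ k) (ψ z) with hX
  have hderiv : deriv (genIntegrationOp n ψ g f - (S f : ℂ → ℂ)) z = X * g z := by
    have h1 := hasDerivAt_genIntegrationOp n hψ hg f.2.1 hzb
    have h2 : HasDerivAt (∑ k ∈ Finset.range N, ((ρ : ℂ) ^ k * taylorCoeff k f) •
        genIntegrationOp n ψ g (discMonomial k)) (∑ k ∈ Finset.range N,
        ((ρ : ℂ) ^ k * taylorCoeff k f) •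
          (iteratedDeriv n (fun ζ => ζ ^ k) (ψ z) * g z)) z := by
      refine HasDerivAt.sum fun k _ => HasDerivAt.const_smul _ ?_
      rw [← iteratedDeriv_discMonomial n k hψz]
      exact hasDerivAt_genIntegrationOp n hψ hg
        (discMonomial_mem_mixedNormSpace hp hq hφ k).1 hzb
    rw [hSapp, (h1.sub h2).deriv, hX, sub_mul, Finset.sum_mul]
    simp only [smul_eq_mul, mul_assoc]
  have hBz := hBb z hz
  have hμg : 0 ≤ μ (‖z‖ : ℂ) * ‖g z‖ := by positivity
  obtain ⟨hX1, hX2⟩ := hρN f f.2.1 hf (ψ z) hψz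
  have hBη : μ (‖z‖ : ℂ) * ‖g z‖ * (ε₁ / B) ≤ ε₁ := by
    calc _ ≤ B * (ε₁ / B) := by gcongr
      _ = ε₁ := by field_simp
  have hε₁eq : C' * ε₁ + ε₁ = ε := by
    rw [hε₁]
    field_simp
  have hgoal : C' * (l + ε₁) + ε₁ = C' * l + ε := by rw [← hε₁eq]; ring
  rw [hderiv, norm_mul, mul_left_comm, mul_comm, ← hgoal]
  rcases le_or_gt ‖ψ z‖ R with h | h
  · calc _ ≤ μ (‖z‖ : ℂ) * ‖g z‖ * (ε₁ / B) := by
          gcongr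
          exact hX2 h
      _ ≤ ε₁ := hBη
      _ ≤ _ := le_add_of_nonneg_left (by positivity)
  · have hφz := hb.pos ‖ψ z‖ ⟨norm_nonneg _, hψz⟩
    have hG := hb.growthWeight_pos q n (norm_nonneg _) hψz
    have hw0 : 0 < φ ‖ψ z‖ * (1 - ‖ψ z‖ ^ 2) ^ (1 / q + (n : ℝ)) :=
      hG.trans_le (growthWeight_le hq n (norm_nonneg _) hψz hφz)
    have hcmp : C / growthWeight q φ n ‖ψ z‖ ≤
        C' / (φ ‖ψ z‖ * (1 - ‖ψ z‖ ^ 2) ^ (1 / q + (n : ℝ))) := by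
      rw [div_le_div_iff₀ hG hw0, hC', mul_assoc]
      exact mul_le_mul_of_nonneg_left
        (le_two_rpow_mul_growthWeight hq n (norm_nonneg _) hψz hφz) hC.le
    calc _ ≤ μ (‖z‖ : ℂ) * ‖g z‖ *
          (C' / (φ ‖ψ z‖ * (1 - ‖ψ z‖ ^ 2) ^ (1 / q + (n : ℝ))) + ε₁ / B) := by
          gcongr
          exact hX1.trans (by gcongr)
      _ = C' * (μ (‖z‖ : ℂ) * ‖g z‖ / (φ ‖ψ z‖ * (1 - ‖ψ z‖ ^ 2) ^ (1 / q + (n : ℝ)))) +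
          μ (‖z‖ : ℂ) * ‖g z‖ * (ε₁ / B) := by ring
      _ ≤ C' * (l + ε₁) + ε₁ := by
          gcongr
          exact hR z hz h

theorem theorem2p7 (p q : ℝ) (hp : 0 < p) (hq : 0 < q) (φ : ℝ → ℝ) (hφ : IsNormalFunction φ)
    (n : ℕ) :
    ∃ c C : ℝ, 0 < c ∧ 0 < C ∧
      ∀ (μ : ℂ → ℝ) (ψ g : ℂ → ℂ), IsWeight μ → IsAnalyticSelfMap ψ →
        DifferentiableOn ℂ g (Metric.ball 0 1) →
        IsBoundedMixedToBloch p q φ hp hq hφ μ (genIntegrationOp n ψ g) →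
        ENNReal.ofReal c * symbolLimsup q φ n μ ψ g ≤
            essentialNorm p q φ hp hq hφ μ (genIntegrationOp n ψ g) ∧
          essentialNorm p q φ hp hq hφ μ (genIntegrationOp n ψ g) ≤
            ENNReal.ofReal C * symbolLimsup q φ n μ ψ g := by
  obtain ⟨c, hc, hlow⟩ := exists_mul_symbolLimsup_le_essentialNorm hp hq hφ n
  obtain ⟨C, hC, hup⟩ := exists_essentialNorm_le_mul_symbolLimsup hp hq hφ n
  exact ⟨c, C, hc, hC, fun μ ψ g hμ hψ hg hT => ⟨hlow μ ψ g hμ hψ hg, hup μ ψ g hμ hψ hg hT⟩⟩
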